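/- Let $K_0=\mathbf F_2(x_0)$ be the rational function field and, for $i\ge 1$, let $K_i=K_{i-1}(x_i)=\mathbf F_2(x_0,\dots,x_i)$, where $x_i$ is a solution, in a fixed algebraic closure of $K_0$, of $$x_i^2+x_i=x_{i-1}+1+\frac1{x_{i-1}}.$$ Let $C_i$ be the smooth projective curve over $\mathbf F_2$ with function field $K_i$, so that $C_0=\mathbf P^1$ with affine coordinate $x_0$, and consider the covers $\cdots\to C_i\to C_{i-1}\to\cdots\to C_0$ given by the inclusions $K_{i-1}\subset K_i$. The functions $x_0,\dots,x_i$ take values in $\mathbf P^1(\mathbf F_8)=\mathbf F_8\cup\{\infty\}$ at the points of $C_i(\mathbf F_8)$. Then for every $i\ge 1$ the cover $C_i\to C_0$ has degree $2^i$, and $$\#C_i(\mathbf F_8)=6\cdot 2^i+2 .$$ More precisely, for each $a\in\mathbf F_8\setminus\mathbf F_2$ the point $x_0=a$ of $C_0(\mathbf F_8)$ splits completely in $C_i\to C_0$, i.e. there are exactly $2^i$ points of $C_i(\mathbf F_8)$ above it. The points of $C_i(\mathbf F_8)$ with $x_0\notin\mathbf F_8\setminus\mathbf F_2$ are exactly two: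 a point $P(0,\infty,\dots,\infty)$, at which $(x_0,x_1,\dots,x_i)=(0,\infty,\dots,\infty)$, and a point $P(\infty,\dots,\infty)$, at which $(x_0,\dots,x_i)=(\infty,\dots,\infty)$; both are totally ramified in $C_i\to C_0$, i.e. have ramification index $2^i$. -/

import Mathlib

noncomputable section

namespace ArtinSchreierTower

/-- An algebraic closure of the rational function field `𝔽₂(x₀)`; the whole tower of function
fields is realized inside it. -/
abbrev Ambient : Type := AlgebraicClosure (RatFunc (ZMod 2))

/-- The Artin–Schreier equation `y² + y = z + 1 + 1/z` can be solved in the ambient field. -/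
theorem exists_next (z : Ambient) : ∃ y : Ambient, y ^ 2 + y = z + 1 + 1 / z := by
  let p : Polynomial Ambient :=
    Polynomial.X ^ 2 + Polynomial.X - Polynomial.C (z + 1 + 1 / z)
  have hp : p.degree = 2 := by
    dsimp only [p]
    compute_degree!
  obtain ⟨y, hy⟩ := IsAlgClosed.exists_root p (by rw [hp]; decide)
  refine ⟨y, ?_⟩
  have h : y ^ 2 + y - (z + 1 + 1 / z) = 0 := by
    simpa [p, Polynomial.IsRoot] using hy
  exact sub_eq_zero.mp h

/-- The coordinate functions: `x₀` is the variable of `𝔽₂(x₀)`, and `xₙ₊₁` is a solution of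
`xₙ₊₁² + xₙ₊₁ = xₙ + 1 + 1/xₙ`. -/
def x : ℕ → Ambient
  | 0 => algebraMap (RatFunc (ZMod 2)) Ambient RatFunc.X
  | n + 1 => Classical.choose (exists_next (x n))

theorem x_zero : x 0 = algebraMap (RatFunc (ZMod 2)) Ambient RatFunc.X := rfl

theorem x_succ (n : ℕ) : x (n + 1) ^ 2 + x (n + 1) = x n + 1 + 1 / x n :=
  Classical.choose_spec (exists_next (x n))

/-- The function field `𝔽₂(Cᵢ) = 𝔽₂(x₀, x₁, …, xᵢ)` of the curve `Cᵢ`. -/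
def functionField (i : ℕ) : IntermediateField (RatFunc (ZMod 2)) Ambient :=
  IntermediateField.adjoin (RatFunc (ZMod 2)) (x '' Set.Iic i)

theorem functionField_mono {l i : ℕ} (h : l ≤ i) : functionField l ≤ functionField i :=
  IntermediateField.adjoin.mono _ _ _ (Set.image_mono (Set.Iic_subset_Iic.mpr h))

/-- The pull back of rational functions `𝔽₂(C_l) → 𝔽₂(Cᵢ)`, for `l ≤ i`. -/
def pullback {l i : ℕ} (h : l ≤ i) : functionField l →+* functionField i :=
  (IntermediateField.inclusion (functionField_mono h)).toRingHom

/-- The coordinate `xⱼ` as a rational function on `Cᵢ`, for `0 ≤ j ≤ i`. -/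
def coordFun (i : ℕ) (j : Fin (i + 1)) : functionField i :=
  ⟨x j, IntermediateField.subset_adjoin _ _ ⟨j, Nat.lt_succ_iff.mp j.isLt, rfl⟩⟩

/-- The degree `[𝔽₂(Cᵢ) : 𝔽₂(C_l)]` of the cover `Cᵢ → C_l`, for `l ≤ i`. -/
def coverDegree (l i : ℕ) : ℕ := (functionField l).relfinrank (functionField i)

/-- The smooth projective curve `Cᵢ` over `𝔽₂`, in its incarnation as the abstract nonsingular
curve of its function field: the closed points are the places, that is, the nontrivial valuation
rings of `𝔽₂(Cᵢ)`, each being the local ring of the curve at the corresponding point. (They contain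
the field of constants `𝔽₂`, as every subring does.) -/
@[ext]
structure ClosedPoint (i : ℕ) where
  /-- The local ring of the curve at the point. -/
  localRing : ValuationSubring (functionField i)
  ne_top : localRing ≠ ⊤

theorem comap_ne_top {l i : ℕ} (h : l ≤ i) (O : ValuationSubring (functionField i))
    (hO : O ≠ ⊤) : O.comap (pullback h) ≠ ⊤ := by
  intro htop
  apply hO
  rw [eq_top_iff]
  intro y _
  obtain ⟨p, hp, hpy⟩ :=
    (Algebra.IsAlgebraic.isAlgebraic (R := RatFunc (ZMod 2)) y).isIntegral
  have hmem : ∀ r : RatFunc (ZMod 2), algebraMap (RatFunc (ZMod 2)) (functionField i) r ∈ O := by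
    intro r
    have hr : algebraMap (RatFunc (ZMod 2)) (functionField l) r ∈ O.comap (pullback h) := by
      rw [htop]; trivial
    rw [ValuationSubring.mem_comap] at hr
    exact hr
  let g : RatFunc (ZMod 2) →+* O :=
    (algebraMap (RatFunc (ZMod 2)) (functionField i)).codRestrict O.toSubring hmem
  have hint : IsIntegral O y := by
    refine ⟨p.map g, hp.map g, ?_⟩
    rw [Polynomial.eval₂_map]
    exact hpy
  obtain ⟨z, hz⟩ := IsIntegrallyClosed.algebraMap_eq_of_integral hint
  rw [← hz]
  exact z.2

/-- The cover `Cᵢ → C_l` on closed points, for `l ≤ i`. -/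
def ClosedPoint.proj {l i : ℕ} (h : l ≤ i) (Q : ClosedPoint i) : ClosedPoint l where
  localRing := Q.localRing.comap (pullback h)
  ne_top := comap_ne_top h _ Q.ne_top

/-- The homomorphism from the local ring of the image of `Q` in `C_l` to the local ring of `Q`. -/
def ClosedPoint.localMap {l i : ℕ} (h : l ≤ i) (Q : ClosedPoint i) :
    (Q.proj h).localRing →+* Q.localRing :=
  (pullback h).restrict (Q.proj h).localRing.toSubring Q.localRing.toSubring fun _ ha => ha

instance {l i : ℕ} (h : l ≤ i) (Q : ClosedPoint i) : IsLocalHom (Q.localMap h) where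
  map_nonunit a ha := by
    obtain ⟨b, hb⟩ := isUnit_iff_exists_inv.mp ha
    have hb' : pullback h (a : functionField l) * (b : functionField i) = 1 :=
      congrArg Subtype.val hb
    have hinv : (b : functionField i) = pullback h ((a : functionField l)⁻¹) := by
      rw [map_inv₀]
      exact eq_inv_of_mul_eq_one_right hb'
    have ha0 : (a : functionField l) ≠ 0 := by
      intro h0
      rw [h0, map_zero, zero_mul] at hb'
      exact zero_ne_one hb'
    refine isUnit_iff_exists_inv.mpr ⟨⟨(a : functionField l)⁻¹, ?_⟩, ?_⟩
    · change pullback h ((a : functionField l)⁻¹) ∈ Q.localRing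
      rw [← hinv]
      exact b.2
    · exact Subtype.ext (mul_inv_cancel₀ ha0)

/-- The ramification index of `Q` in the cover `Cᵢ → C_l`. -/
def ClosedPoint.ramificationIdx {l i : ℕ} (h : l ≤ i) (Q : ClosedPoint i) : ℕ :=
  letI : Algebra (Q.proj h).localRing Q.localRing := (Q.localMap h).toAlgebra
  Ideal.ramificationIdx' (IsLocalRing.maximalIdeal (Q.proj h).localRing)
    (IsLocalRing.maximalIdeal Q.localRing)

/-- `Q` is totally ramified in the cover `Cᵢ → C_l`. -/
def ClosedPoint.IsTotallyRamified {l i : ℕ} (h : l ≤ i) (Q : ClosedPoint i) : Prop :=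
  Q.ramificationIdx h = coverDegree l i

/-- The set `Cᵢ(F)` of points of `Cᵢ` with values in a field `F`, that is, of morphisms
`Spec F → Cᵢ` with image a closed point: a closed point together with a local homomorphism from its
local ring to `F` (equivalently, an embedding of its residue field into `F`). When `F` is finite,
these are all the morphisms `Spec F → Cᵢ`. -/
structure RationalPoint (i : ℕ) (F : Type*) [Field F] extends ClosedPoint i where
  /-- The evaluation of the functions that are regular at the point. -/
  eval : localRing →+* F
  isLocalHom_eval : IsLocalHom eval

namespace RationalPoint

variable {F : Type*} [Field F]

open Classical in
/-- The coordinate `xⱼ(P)`, an element of `ℙ¹(F) = F ∪ {∞}`. -/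
def coord {i : ℕ} (P : RationalPoint i F) (j : Fin (i + 1)) : OnePoint F :=
  if h : coordFun i j ∈ P.localRing then ((P.eval ⟨coordFun i j, h⟩ : F) : OnePoint F)
  else OnePoint.infty

/-- The map `Cᵢ(F) → C_l(F)` induced by the cover `Cᵢ → C_l`, for `l ≤ i`. -/
def proj {l i : ℕ} (h : l ≤ i) (Q : RationalPoint i F) : RationalPoint l F where
  toClosedPoint := Q.toClosedPoint.proj h
  eval := Q.eval.comp (Q.toClosedPoint.localMap h)
  isLocalHom_eval := by
    have := Q.isLocalHom_eval
    exact RingHom.isLocalHom_comp _ _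

/-- The `F`-rational point `P` of `C_l` splits completely in the cover `Cᵢ → C_l`: the number of
`F`-rational points of `Cᵢ` above `P` is the degree of the cover. -/
def SplitsCompletely {l : ℕ} (P : RationalPoint l F) {i : ℕ} (h : l ≤ i) : Prop :=
  Nat.card {Q : RationalPoint i F // Q.proj h = P} = coverDegree l i

end RationalPoint

end ArtinSchreierTower

end

/-!
A point of `Cᵢ` is a place: a valuation ring of the function field together with an evaluation. If
`u` has a simple pole at a place of `K`, then in `L = K(y)` with `y² + y = u` the valuation of `u`
is twice that of `y`, so the valuations of `a` and of `b * y` have different parities for all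
nonzero `a, b ∈ K`. The valuation and the evaluation of `a + b * y` are thus determined by the place
of `K`: there is exactly one place above it, it is totally ramified, and `y` has a simple pole
there. Since `z + 1 + 1/z` has a simple pole wherever `z` does, this propagates up the tower. It
starts at `x₀ = ∞` and, by the symmetry `z ↔ 1/z` of `z + 1 + 1/z`, also at `x₀ = 0`.

If instead `u` has a value `d`, the equation `c² + c = d` is separable, and the places above
correspond to its roots. In `𝔽₈`, the element `a + 1 + 1/a` has trace zero and does not vanish for
`a ∈ 𝔽₈ ∖ 𝔽₂`, so there are two roots, and both lie in `𝔽₈ ∖ 𝔽₂` again: these points split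
completely. There are no points with `x₀ = 1` when `i ≥ 1`, because `c² + c = 1` has no root in
`𝔽₈`.
-/

/-- An `F`-valued place of a field `K`: a valuation subring with a local homomorphism to `F`. This
is an `F`-rational point of a curve with function field `K`, in a form that makes sense for an
arbitrary field `K`. -/
structure Place (K F : Type*) [Field K] [Field F] where
  /-- The ring of functions that are regular at the place. -/
  ring : ValuationSubring K
  /-- The evaluation of regular functions. -/
  eval : ring →+* F
  isLocalHom_eval : IsLocalHom eval

namespace Place

variable {K L F : Type*} [Field K] [Field L] [Field F]

/-- The function `z` is regular at the place `P`, with value `c`. -/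
def HasValue (P : Place K F) (z : K) (c : F) : Prop := ∃ h : z ∈ P.ring, P.eval ⟨z, h⟩ = c

variable {P Q : Place K F} {z w : K} {c d : F}

theorem HasValue.mem (h : P.HasValue z c) : z ∈ P.ring := h.1

theorem hasValue_coe (P : Place K F) (z : P.ring) : P.HasValue z (P.eval z) := ⟨z.2, rfl⟩

theorem HasValue.unique (hc : P.HasValue z c) (hd : P.HasValue z d) : c = d := by
  obtain ⟨_, rfl⟩ := hc
  obtain ⟨_, rfl⟩ := hd
  rfl

theorem hasValue_zero : P.HasValue 0 0 := ⟨zero_mem _, map_zero P.eval⟩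

theorem hasValue_one : P.HasValue 1 1 := ⟨one_mem _, map_one P.eval⟩

theorem HasValue.add (hz : P.HasValue z c) (hw : P.HasValue w d) : P.HasValue (z + w) (c + d) := by
  obtain ⟨hz, rfl⟩ := hz
  obtain ⟨hw, rfl⟩ := hw
  exact ⟨add_mem hz hw, map_add P.eval ⟨z, hz⟩ ⟨w, hw⟩⟩

theorem HasValue.mul (hz : P.HasValue z c) (hw : P.HasValue w d) : P.HasValue (z * w) (c * d) := by
  obtain ⟨hz, rfl⟩ := hz
  obtain ⟨hw, rfl⟩ := hw
  exact ⟨mul_mem hz hw, map_mul P.eval ⟨z, hz⟩ ⟨w, hw⟩⟩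

theorem HasValue.ne_zero (h : P.HasValue z c) (hc : c ≠ 0) : z ≠ 0 := by
  rintro rfl
  exact hc (h.unique hasValue_zero)

theorem HasValue.inv (h : P.HasValue z c) (hc : c ≠ 0) : P.HasValue z⁻¹ c⁻¹ := by
  obtain ⟨hz, rfl⟩ := h
  have := P.isLocalHom_eval
  obtain ⟨v, hv⟩ := isUnit_iff_exists_inv.mp (isUnit_of_map_unit P.eval ⟨z, hz⟩ hc.isUnit)
  have hvz : (v : K) = z⁻¹ := eq_inv_of_mul_eq_one_right (congrArg Subtype.val hv)
  rw [← hvz]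
  refine ⟨v.2, eq_inv_of_mul_eq_one_right ?_⟩
  rw [← map_mul, hv, map_one]

theorem HasValue.div (hz : P.HasValue z c) (hw : P.HasValue w d) (hd : d ≠ 0) :
    P.HasValue (z / w) (c / d) := by
  rw [div_eq_mul_inv, div_eq_mul_inv]
  exact hz.mul (hw.inv hd)

theorem exists_hasValue_or_inv (P : Place K F) (z : K) :
    (∃ c, P.HasValue z c) ∨ P.HasValue z⁻¹ 0 := by
  rcases P.ring.mem_or_inv_mem z with h | h
  · exact Or.inl ⟨_, h, rfl⟩
  · by_cases h0 : P.eval ⟨z⁻¹, h⟩ = 0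
    · exact Or.inr ⟨h, h0⟩
    · have hz := HasValue.inv ⟨h, rfl⟩ h0
      rw [inv_inv] at hz
      exact Or.inl ⟨_, hz⟩

theorem HasValue.inv_notMem (h : P.HasValue z 0) (hz : z ≠ 0) : z⁻¹ ∉ P.ring := by
  intro hmem
  have h1 := h.mul (P.hasValue_coe ⟨_, hmem⟩)
  rw [mul_inv_cancel₀ hz, zero_mul] at h1
  exact one_ne_zero (hasValue_one.unique h1)

theorem hasValue_zero_iff_inv_notMem (hz : z ≠ 0) : P.HasValue z 0 ↔ z⁻¹ ∉ P.ring := by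
  refine ⟨fun h => h.inv_notMem hz, fun h => ?_⟩
  rcases P.exists_hasValue_or_inv z⁻¹ with ⟨c, hc⟩ | hc
  · exact absurd hc.mem h
  · rwa [inv_inv] at hc

theorem hasValue_zero_iff : P.HasValue z 0 ↔ P.ring.valuation z < 1 := by
  rcases eq_or_ne z 0 with rfl | hz
  · simp only [hasValue_zero, map_zero, zero_lt_one]
  · rw [hasValue_zero_iff_inv_notMem hz, ← ValuationSubring.valuation_le_one_iff, not_le, map_inv₀,
      one_lt_inv₀ ((Valuation.pos_iff _).mpr hz)]

theorem HasValue.valuation_eq_one (h : P.HasValue z c) (hc : c ≠ 0) : P.ring.valuation z = 1 := by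
  refine ((P.ring.valuation_le_one_iff z).mpr h.mem).eq_of_not_lt fun hlt => ?_
  exact hc (h.unique (hasValue_zero_iff.mpr hlt))

theorem ext_of_hasValue (h : ∀ z c, P.HasValue z c → Q.HasValue z c) : P = Q := by
  have hring : P.ring = Q.ring := by
    ext z
    refine ⟨fun hz => (h z _ (P.hasValue_coe ⟨z, hz⟩)).mem, fun hz => ?_⟩
    rcases P.exists_hasValue_or_inv z with ⟨c, hc⟩ | hc
    · exact hc.mem
    · rcases eq_or_ne z 0 with rfl | hz0
      · exact zero_mem _
      · have hz' := (h _ _ hc).inv_notMem (inv_ne_zero hz0)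
        rw [inv_inv] at hz'
        exact absurd hz hz'
  obtain ⟨A, e, he⟩ := P
  obtain ⟨B, e', he'⟩ := Q
  obtain rfl : A = B := hring
  congr
  ext z
  exact ((h z _ ⟨z.2, rfl⟩).2).symm

/-- The restriction of a place along an embedding of fields. -/
def comap (f : K →+* L) (Q : Place L F) : Place K F where
  ring := Q.ring.comap f
  eval := Q.eval.comp (f.restrict (Q.ring.comap f).toSubring Q.ring.toSubring fun _ h => h)
  isLocalHom_eval := by
    refine ⟨fun a ha => ?_⟩
    have hval : Q.HasValue (f a) (Q.eval ⟨f a, a.2⟩) := ⟨a.2, rfl⟩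
    have hinv := hval.inv ha.ne_zero
    have ha0 : (a : K) ≠ 0 := fun h0 => hval.ne_zero ha.ne_zero (by rw [h0, map_zero])
    rw [← map_inv₀] at hinv
    exact isUnit_iff_exists_inv.mpr ⟨⟨(a : K)⁻¹, hinv.mem⟩, Subtype.ext (mul_inv_cancel₀ ha0)⟩

theorem hasValue_comap {f : K →+* L} {Q : Place L F} :
    (Q.comap f).HasValue z c ↔ Q.HasValue (f z) c := Iff.rfl

theorem comap_eq_iff {f : K →+* L} {Q : Place L F} :
    Q.comap f = P ↔ ∀ z c, P.HasValue z c → Q.HasValue (f z) c :=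
  ⟨fun h _ _ => by rw [← h]; exact id, fun h => (ext_of_hasValue h).symm⟩

/-- The evaluation of a trivial place would embed the infinite field `K` in `F`. -/
theorem ring_ne_top [Infinite K] [Finite F] (P : Place K F) : P.ring ≠ ⊤ := by
  intro h
  let inc : K →+* P.ring := (RingHom.id K).codRestrict P.ring.toSubring fun z => by
    simp only [h]
    trivial
  exact not_injective_infinite_finite _ (P.eval.comp inc).injective

theorem exists_of_residue_surjective {S : Type*} [CommRing S] (B : ValuationSubring L) (ι : S →+* B)
    (φ : S →+* F) (hι : Function.Surjective ((IsLocalRing.residue B).comp ι))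
    (hφ : ∀ s, ι s ∈ IsLocalRing.maximalIdeal B → φ s = 0) :
    ∃ Q : Place L F, Q.ring = B ∧ ∀ s, Q.HasValue (ι s) (φ s) := by
  have hker : RingHom.ker ((IsLocalRing.residue B).comp ι) ≤ RingHom.ker φ := fun s hs =>
    hφ s ((IsLocalRing.residue_eq_zero_iff _).mp hs)
  let e := RingHom.liftOfSurjective _ hι ⟨φ, hker⟩
  refine ⟨⟨B, e.comp (IsLocalRing.residue B), RingHom.isLocalHom_comp _ _⟩, rfl, fun s =>
    ⟨(ι s).2, ?_⟩⟩
  exact RingHom.liftOfRightInverse_comp_apply _ _ (Function.rightInverse_surjInv hι) ⟨φ, hker⟩ s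

section Fractions

variable {R : Type*} [CommRing R] {ι : R →+* L} {φ : R →+* F}

theorem eq_of_fractions {Q Q' : Place L F}
    (hfrac : ∀ z, ∃ r s, z * ι s = ι r ∧ (φ r ≠ 0 ∨ φ s ≠ 0))
    (hQ : ∀ r, Q.HasValue (ι r) (φ r)) (hQ' : ∀ r, Q'.HasValue (ι r) (φ r)) : Q = Q' := by
  refine ext_of_hasValue fun z c hc => ?_
  obtain ⟨r, s, hz, hrs⟩ := hfrac z
  have hcs : c * φ s = φ r := (hc.mul (hQ s)).unique (hz ▸ hQ r)
  have hs : φ s ≠ 0 := by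
    rintro hs
    simp only [← hcs, hs, mul_zero, ne_eq, not_true_eq_false, or_self] at hrs
  rw [eq_div_of_mul_eq ((hQ s).ne_zero hs) hz, eq_div_of_mul_eq hs hcs]
  exact (hQ' r).div (hQ' s) hs

/-- The valuation ring is the image in `L` of the localization of `R` at the kernel of `φ`. -/
theorem exists_of_fractions (hker : ∀ r, ι r = 0 → φ r = 0)
    (hfrac : ∀ z, ∃ r s, z * ι s = ι r ∧ (φ r ≠ 0 ∨ φ s ≠ 0)) :
    ∃ Q : Place L F, ∀ r, Q.HasValue (ι r) (φ r) := by
  have := RingHom.ker_isPrime φ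
  have hφ : ∀ s : (RingHom.ker φ).primeCompl, IsUnit (φ s) := fun s => IsUnit.mk0 _ s.2
  have hι : ∀ s : (RingHom.ker φ).primeCompl, IsUnit (ι s) := fun s =>
    IsUnit.mk0 _ fun h => s.2 (hker _ h)
  let loc := Localization.AtPrime (RingHom.ker φ)
  let ιloc : loc →+* L := IsLocalization.lift hι
  let φloc : loc →+* F := IsLocalization.lift hφ
  have mem_range : ∀ {z : L} {r s : R}, z * ι s = ι r → φ s ≠ 0 → z ∈ ιloc.range := by
    intro z r s hz hs
    refine ⟨IsLocalization.mk' loc r (⟨s, hs⟩ : (RingHom.ker φ).primeCompl), ?_⟩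
    rw [IsLocalization.lift_mk'_spec, ← hz, mul_comm]
  let B : ValuationSubring L :=
    { ιloc.range with
      mem_or_inv_mem' := by
        intro z
        obtain ⟨r, s, hz, hr | hs⟩ := hfrac z
        · refine Or.inr (mem_range (r := s) (s := r) ?_ hr)
          have hz0 : z ≠ 0 := fun h => hr (hker r (by rw [← hz, h, zero_mul]))
          rw [← hz, inv_mul_cancel_left₀ hz0]
        · exact Or.inl (mem_range hz hs) }
  obtain ⟨Q, -, hQ⟩ := exists_of_residue_surjective B ιloc.rangeRestrict φloc
    (IsLocalRing.residue_surjective.comp ιloc.rangeRestrict_surjective) fun l hl => by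
      obtain ⟨r, s, rfl⟩ := IsLocalization.exists_mk'_eq (RingHom.ker φ).primeCompl l
      have hr : r ∈ RingHom.ker φ := by
        by_contra hr
        have hunit := (IsLocalization.AtPrime.isUnit_mk'_iff loc (RingHom.ker φ) r s).mpr hr
        exact (IsLocalRing.mem_maximalIdeal _).mp hl (hunit.map ιloc.rangeRestrict)
      rw [IsLocalization.lift_mk', (RingHom.mem_ker).mp hr, zero_mul]
  refine ⟨Q, fun r => ?_⟩
  have hr : Q.HasValue (ιloc (algebraMap R loc r)) (φloc (algebraMap R loc r)) := hQ _
  rwa [IsLocalization.lift_eq, IsLocalization.lift_eq] at hr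

theorem exists_fraction_of_mul_eq {A : ValuationSubring K} {f : K →+* L} {κ : A →+* R}
    (hκ : ∀ t, ι (κ t) = f t) {z : L} {t : K} {r s : R} (hz : z * ι s = f t * ι r)
    (hr : φ r ≠ 0) (hs : φ s ≠ 0) : ∃ r s, z * ι s = ι r ∧ (φ r ≠ 0 ∨ φ s ≠ 0) := by
  rcases eq_or_ne t 0 with rfl | ht0
  · exact ⟨0, s, by rw [hz, map_zero, map_zero, zero_mul], Or.inr hs⟩
  rcases A.mem_or_inv_mem t with ht | ht
  · exact ⟨κ ⟨t, ht⟩ * r, s, by rw [map_mul, hκ, hz], Or.inr hs⟩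
  · refine ⟨r, κ ⟨t⁻¹, ht⟩ * s, ?_, Or.inl hr⟩
    rw [map_mul, hκ, mul_left_comm, hz, ← mul_assoc, ← map_mul, inv_mul_cancel₀ ht0, map_one,
      one_mul]

end Fractions

end Place

section SimplePoles

variable {K L Γ : Type*} [Field K] [Field L] [LinearOrderedCommGroupWithZero Γ]

/-- The valuation `v` is discrete, and the function `u` has a simple pole there: `v u` is greater
than `1` and generates the value group. Poles are used instead of uniformizers because the
functions that generate the tower are unbounded at the ramified points. -/
structure HasSimplePole (v : Valuation K Γ) (u : K) : Prop where
  one_lt : 1 < v u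
  exists_zpow : ∀ z, z ≠ 0 → ∃ n : ℤ, v z = v u ^ n

theorem HasSimplePole.of_valuation_eq {v : Valuation K Γ} {u w : K} (hu : HasSimplePole v u)
    (huw : v u = v w) : HasSimplePole v w :=
  ⟨huw ▸ hu.one_lt, huw ▸ hu.exists_zpow⟩

theorem HasSimplePole.of_isEquiv {Γ' : Type*} [LinearOrderedCommGroupWithZero Γ']
    {v : Valuation K Γ} {v' : Valuation K Γ'} {u : K} (hu : HasSimplePole v u)
    (h : v.IsEquiv v') : HasSimplePole v' u where
  one_lt := h.one_lt_iff_one_lt.mp hu.one_lt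
  exists_zpow z hz := by
    obtain ⟨n, hn⟩ := hu.exists_zpow z hz
    rw [← map_zpow₀] at hn
    exact ⟨n, by rw [← map_zpow₀, h.eq_iff.mp hn]⟩

theorem valuation_add_one_add_inv {v : Valuation K Γ} {z : K} (hz : 1 < v z) :
    v (z + 1 + 1 / z) = v z := by
  have hadd : v (z + 1) = v z := v.map_add_eq_of_lt_left (by rwa [map_one])
  have hinv : v (1 / z) < 1 := by
    rw [one_div, map_inv₀]
    exact inv_lt_one_of_one_lt₀ hz
  rw [v.map_add_eq_of_lt_left (hadd ▸ hinv.trans hz), hadd]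

theorem isEquiv_valuation_comap (f : K →+* L) (B : ValuationSubring L) :
    (B.valuation.comap f).IsEquiv (B.comap f).valuation := by
  refine Valuation.isEquiv_of_val_le_one fun {z} => ?_
  rw [Valuation.comap_apply, ValuationSubring.valuation_le_one_iff,
    ValuationSubring.valuation_le_one_iff, ValuationSubring.mem_comap]

end SimplePoles

/-- The field `L` is generated over the image of `K` by a root `y` of the Artin–Schreier equation
`y² + y = u`. Irreducibility of the equation is not part of the notion. -/
structure IsArtinSchreierGenerator {K L : Type*} [Field K] [Field L] (f : K →+* L) (u : K)
    (y : L) : Prop where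
  sq_add_self : y ^ 2 + y = f u
  exists_eq_add_mul : ∀ z, ∃ a b, z = f a + f b * y

namespace IsArtinSchreierGenerator

variable {K L Γ : Type*} [Field K] [Field L] [LinearOrderedCommGroupWithZero Γ]
  {f : K →+* L} {u : K} {y : L}

section Ramified

variable {v : Valuation L Γ} (hy : IsArtinSchreierGenerator f u y)
  (hu : HasSimplePole (v.comap f) u)

include hy hu

theorem one_lt_valuation : 1 < v y := by
  by_contra! hle
  have hu1 : 1 < v (y ^ 2 + y) := hy.sq_add_self ▸ hu.one_lt
  refine hu1.not_ge (v.map_add_le ?_ hle)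
  rw [map_pow]
  exact pow_le_one' hle 2

theorem valuation_map_eq_sq : v (f u) = v y ^ 2 := by
  have hlt : v y < v (y ^ 2) := by
    rw [map_pow]
    exact lt_self_pow₀ (hy.one_lt_valuation hu) one_lt_two
  rw [← hy.sq_add_self, v.map_add_eq_of_lt_left hlt, map_pow]

theorem exists_valuation_map_eq_zpow {a : K} (ha : a ≠ 0) : ∃ n : ℤ, v (f a) = v y ^ (2 * n) := by
  obtain ⟨n, hn⟩ := hu.exists_zpow a ha
  refine ⟨n, ?_⟩
  rw [Valuation.comap_apply, Valuation.comap_apply, hy.valuation_map_eq_sq hu] at hn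
  rw [hn, zpow_mul, zpow_ofNat]

theorem exists_valuation_mul_eq_zpow {b : K} (hb : b ≠ 0) :
    ∃ n : ℤ, v (f b * y) = v y ^ (2 * n + 1) := by
  obtain ⟨n, hn⟩ := hy.exists_valuation_map_eq_zpow hu hb
  refine ⟨n, ?_⟩
  rw [map_mul, hn, zpow_add_one₀ (zero_lt_one.trans (hy.one_lt_valuation hu)).ne']

theorem zpow_valuation_injective : Function.Injective fun n : ℤ => v y ^ n :=
  zpow_right_injective₀ (zero_lt_one.trans (hy.one_lt_valuation hu)) (hy.one_lt_valuation hu).ne'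

theorem valuation_map_ne_valuation_mul {a b : K} (ha : a ≠ 0) (hb : b ≠ 0) :
    v (f a) ≠ v (f b * y) := by
  obtain ⟨m, hm⟩ := hy.exists_valuation_map_eq_zpow hu ha
  obtain ⟨n, hn⟩ := hy.exists_valuation_mul_eq_zpow hu hb
  rw [hm, hn]
  intro h
  have := hy.zpow_valuation_injective hu h
  lia

theorem valuation_add_mul (a b : K) : v (f a + f b * y) = max (v (f a)) (v (f b * y)) := by
  rcases eq_or_ne a 0 with rfl | ha
  · simp only [map_zero, zero_add, zero_le, max_eq_right]
  rcases eq_or_ne b 0 with rfl | hb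
  · simp only [map_zero, zero_mul, add_zero, zero_le, max_eq_left]
  exact v.map_add_of_distinct_val (hy.valuation_map_ne_valuation_mul hu ha hb)

theorem valuation_mul_ne_one (b : K) : v (f b * y) ≠ 1 := by
  rcases eq_or_ne b 0 with rfl | hb
  · simp only [map_zero, zero_mul, ne_eq, zero_ne_one, not_false_eq_true]
  · simpa only [map_one] using (hy.valuation_map_ne_valuation_mul hu one_ne_zero hb).symm

theorem valuation_add_mul_le_one_iff {a b : K} :
    v (f a + f b * y) ≤ 1 ↔ v (f a) ≤ 1 ∧ v (f b * y) < 1 := by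
  rw [hy.valuation_add_mul hu, max_le_iff, (hy.valuation_mul_ne_one hu b).le_iff_lt]

theorem valuation_mul_lt_one_iff {b : K} : v (f b * y) < 1 ↔ v (f (b ^ 2 * u)) < 1 := by
  have hsq : v (f (b ^ 2 * u)) = v (f b * y) ^ 2 := by
    rw [map_mul, map_mul, map_mul, hy.valuation_map_eq_sq hu, map_pow, map_pow, mul_pow]
  rw [hsq, pow_lt_one_iff_of_nonneg zero_le two_ne_zero]

theorem hasSimplePole : HasSimplePole v y where
  one_lt := hy.one_lt_valuation hu
  exists_zpow z hz := by
    obtain ⟨a, b, rfl⟩ := hy.exists_eq_add_mul z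
    have hz0 := (v.ne_zero_iff).mpr hz
    rw [hy.valuation_add_mul hu] at hz0 ⊢
    rcases max_choice (v (f a)) (v (f b * y)) with hmax | hmax <;> rw [hmax] at hz0 ⊢
    · have ha : a ≠ 0 := fun h => hz0 (by rw [h, map_zero, map_zero])
      obtain ⟨n, hn⟩ := hy.exists_valuation_map_eq_zpow hu ha
      exact ⟨2 * n, hn⟩
    · have hb : b ≠ 0 := fun h => hz0 (by rw [h, map_zero, zero_mul, map_zero])
      obtain ⟨n, hn⟩ := hy.exists_valuation_mul_eq_zpow hu hb
      exact ⟨2 * n + 1, hn⟩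

theorem notMem_range : y ∉ f.range := by
  rintro ⟨a, rfl⟩
  have ha : a ≠ 0 := by
    rintro rfl
    simpa using hy.one_lt_valuation hu
  refine hy.valuation_map_ne_valuation_mul hu ha one_ne_zero ?_
  rw [map_one, one_mul]

end Ramified

end IsArtinSchreierGenerator

section RamificationIndex

variable {K : Type*} [Field K] {A : ValuationSubring K} {u : K}

theorem HasSimplePole.inv_mem (hu : HasSimplePole A.valuation u) : u⁻¹ ∈ A := by
  rw [← A.valuation_le_one_iff, map_inv₀]
  exact inv_le_one_of_one_le₀ hu.one_lt.le

theorem HasSimplePole.maximalIdeal_eq_span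
    (hu : HasSimplePole A.valuation u) :
    IsLocalRing.maximalIdeal A = Ideal.span {⟨u⁻¹, hu.inv_mem⟩} := by
  ext z
  rw [Ideal.mem_span_singleton']
  have hle : A.valuation z < 1 ↔ A.valuation z ≤ A.valuation u⁻¹ := by
    rw [map_inv₀]
    refine ⟨fun hz => ?_, fun hz => hz.trans_lt (inv_lt_one_of_one_lt₀ hu.one_lt)⟩
    rcases eq_or_ne (z : K) 0 with hz0 | hz0
    · rw [hz0, map_zero]
      exact zero_le
    obtain ⟨n, hn⟩ := hu.exists_zpow z hz0
    rw [hn, zpow_lt_one_iff_right₀ hu.one_lt] at hz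
    rw [hn, ← zpow_neg_one]
    exact zpow_le_zpow_right₀ hu.one_lt.le (by lia)
  rw [A.valuation_lt_one_iff, hle, A.valuation_le_iff]
  exact ⟨fun ⟨a, ha⟩ => ⟨a, Subtype.ext ha⟩, fun ⟨a, ha⟩ => ⟨a, congrArg Subtype.val ha⟩⟩

theorem ramificationIdx_span_singleton {R S : Type*} [CommRing R] [CommRing S] [IsDomain S]
    [Algebra R S] {r : R} {s : S} {e : ℕ} (hs0 : s ≠ 0) (hs : ¬ IsUnit s)
    (h : Associated (algebraMap R S r) (s ^ e)) :
    Ideal.ramificationIdx' (Ideal.span {r}) (Ideal.span {s}) = e := by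
  have hmap : (Ideal.span {r}).map (algebraMap R S) = Ideal.span {s ^ e} := by
    rw [Ideal.map_span, Set.image_singleton, Ideal.span_singleton_eq_span_singleton.mpr h]
  refine Ideal.ramificationIdx'_spec ?_ ?_
  · rw [hmap, Ideal.span_singleton_pow]
  · rw [hmap, Ideal.span_singleton_pow, Ideal.span_singleton_le_span_singleton,
      pow_dvd_pow_iff hs0 hs]
    exact e.lt_succ_self.not_ge

end RamificationIndex

theorem exists_valuationSubring_comap_eq {K L : Type*} [Field K] [Field L] (f : K →+* L)
    (A : ValuationSubring K) : ∃ B : ValuationSubring L, B.comap f = A := by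
  obtain ⟨B, hB, hloc⟩ := IsLocalRing.exists_factor_valuationRing (f.comp A.subtype)
  refine ⟨B, ?_⟩
  ext a
  refine ⟨fun ha => ?_, fun ha => hB ⟨a, ha⟩⟩
  by_contra hmem
  have hinv : a⁻¹ ∈ A := (A.mem_or_inv_mem a).resolve_left hmem
  have ha0 : a ≠ 0 := fun h => hmem (h ▸ zero_mem A)
  have hunit : IsUnit (⟨a⁻¹, hinv⟩ : A) := by
    refine hloc.map_nonunit _ (isUnit_iff_exists_inv.mpr ⟨⟨f a, ha⟩, Subtype.ext ?_⟩)
    change f a⁻¹ * f a = 1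
    rw [← map_mul, inv_mul_cancel₀ ha0, map_one]
  obtain ⟨w, hw⟩ := isUnit_iff_exists_inv.mp hunit
  have hwa : (w : K) = a := by
    rw [← inv_inv a]
    exact eq_inv_of_mul_eq_one_right (congrArg Subtype.val hw)
  exact hmem (hwa ▸ w.2)

namespace IsArtinSchreierGenerator

variable {K L F : Type*} [Field K] [Field L] [Field F] {f : K →+* L} {u : K} {y : L}
  {P : Place K F}

section RamifiedPlace

variable (hy : IsArtinSchreierGenerator f u y)

include hy

theorem hasValue_add_mul_iff {Q : Place L F} (hu : HasSimplePole (Q.ring.valuation.comap f) u)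
    {a b : K} {c : F} :
    Q.HasValue (f a + f b * y) c ↔ Q.HasValue (f a) c ∧ Q.HasValue (f (b ^ 2 * u)) 0 := by
  rw [Place.hasValue_zero_iff (z := f _), ← hy.valuation_mul_lt_one_iff hu,
    ← Place.hasValue_zero_iff]
  refine ⟨fun hz => ?_, fun ⟨ha, hb⟩ => by simpa only [add_zero] using ha.add hb⟩
  have hle := (hy.valuation_add_mul_le_one_iff hu).mp ((Q.ring.valuation_le_one_iff _).mpr hz.mem)
  have hb := Place.hasValue_zero_iff.mpr hle.2
  obtain ⟨d, hd⟩ : ∃ d, Q.HasValue (f a) d := ⟨_, (Q.ring.valuation_le_one_iff _).mp hle.1, rfl⟩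
  obtain rfl : d = c := by simpa only [add_zero] using (hd.add hb).unique hz
  exact ⟨hd, hb⟩

theorem exists_place_comap_eq_of_hasSimplePole (hu : HasSimplePole P.ring.valuation u) :
    ∃ Q : Place L F, Q.comap f = P := by
  obtain ⟨B, hB⟩ := exists_valuationSubring_comap_eq f P.ring
  have hequiv : (B.valuation.comap f).IsEquiv P.ring.valuation := hB ▸ isEquiv_valuation_comap f B
  have hmap : ∀ a : P.ring, f a ∈ B := fun a => hB.ge a.2
  let ι : P.ring →+* B := (f.comp P.ring.subtype).codRestrict B.toSubring hmap
  have hsurj : Function.Surjective ((IsLocalRing.residue B).comp ι) := by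
    refine IsLocalRing.residue_surjective.forall.mpr fun ⟨z, hz⟩ => ?_
    obtain ⟨a, b, rfl⟩ := hy.exists_eq_add_mul z
    obtain ⟨ha, hb⟩ := (hy.valuation_add_mul_le_one_iff (hu.of_isEquiv hequiv.symm)).mp
      ((B.valuation_le_one_iff _).mpr hz)
    have haP : a ∈ P.ring := hB ▸ (B.valuation_le_one_iff _).mp ha
    have hlt : B.valuation (f a - (f a + f b * y)) < 1 := by
      rwa [sub_add_cancel_left, Valuation.map_neg]
    refine ⟨⟨a, haP⟩, ?_⟩
    rw [RingHom.comp_apply, ← sub_eq_zero, ← map_sub, IsLocalRing.residue_eq_zero_iff]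
    exact (B.valuation_lt_one_iff _).mpr hlt
  have hker : ∀ a, ι a ∈ IsLocalRing.maximalIdeal B → P.eval a = 0 := fun a ha => by
    have hlt : B.valuation (f a) < 1 := (B.valuation_lt_one_iff _).mp ha
    exact (P.hasValue_coe a).unique (Place.hasValue_zero_iff.mpr (hequiv.lt_one_iff_lt_one.mp hlt))
  obtain ⟨Q, -, hQ⟩ := Place.exists_of_residue_surjective B ι P.eval hsurj hker
  exact ⟨Q, Place.comap_eq_iff.mpr fun z c ⟨hz, hc⟩ => hc ▸ hQ ⟨z, hz⟩⟩

theorem existsUnique_place_comap_eq_of_hasSimplePole (hu : HasSimplePole P.ring.valuation u) :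
    ∃! Q : Place L F, Q.comap f = P := by
  refine existsUnique_of_exists_of_unique (hy.exists_place_comap_eq_of_hasSimplePole hu) ?_
  rintro Q Q' rfl hQ'
  have hu_of_comap (R : Place L F) (hR : R.comap f = Q.comap f) :
      HasSimplePole (R.ring.valuation.comap f) u := by
    rw [← hR] at hu
    exact hu.of_isEquiv (isEquiv_valuation_comap f R.ring).symm
  refine Place.ext_of_hasValue fun z c hz => ?_
  obtain ⟨a, b, rfl⟩ := hy.exists_eq_add_mul z
  have hab := (hy.hasValue_add_mul_iff (hu_of_comap Q rfl)).mp hz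
  rw [← Place.hasValue_comap, ← Place.hasValue_comap, ← hQ'] at hab
  exact (hy.hasValue_add_mul_iff (hu_of_comap Q' hQ')).mpr hab

end RamifiedPlace

end IsArtinSchreierGenerator

/-- The evaluation at a root `t` of `t² + t = u` of the elements of the quadratic algebra
`A[ω]/(ω² + ω - u)`, with coefficients mapped by `g`. -/
def quadraticEval {A B : Type*} [CommRing A] [CommRing B] (g : A →+* B) {u : A} {t : B}
    (ht : t ^ 2 + t = g u) : QuadraticAlgebra A u (-1) →+* B where
  toFun w := g w.re + g w.im * t
  map_zero' := by
    simp only [QuadraticAlgebra.re_zero, QuadraticAlgebra.im_zero, map_zero, zero_mul, add_zero]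
  map_one' := by
    simp only [QuadraticAlgebra.re_one, QuadraticAlgebra.im_one, map_one, map_zero, zero_mul,
      add_zero]
  map_add' w w' := by
    simp only [QuadraticAlgebra.re_add, QuadraticAlgebra.im_add, map_add]
    ring
  map_mul' w w' := by
    simp only [QuadraticAlgebra.re_mul, QuadraticAlgebra.im_mul, map_add, map_mul, map_neg, map_one]
    linear_combination -g w.im * g w'.im * ht

theorem quadraticEval_apply {A B : Type*} [CommRing A] [CommRing B] (g : A →+* B) {u : A} {t : B}
    (ht : t ^ 2 + t = g u) (w : QuadraticAlgebra A u (-1)) :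
    quadraticEval g ht w = g w.re + g w.im * t := rfl

theorem quadraticEval_star_ne_zero {A F : Type*} [CommRing A] [Field F] (φ : A →+* F) {u : A}
    {c : F} (hc : c ^ 2 + c = φ u) (hsep : 1 + 2 * c ≠ 0) {w : QuadraticAlgebra A u (-1)}
    (hw : w.re = 1 ∨ w.im = 1) (h0 : quadraticEval φ hc w = 0) :
    quadraticEval φ hc (star w) ≠ 0 := by
  rw [quadraticEval_apply] at h0
  have him : φ w.im ≠ 0 := by
    intro him
    rcases hw with hw | hw
    · rw [him, hw, map_one, zero_mul, add_zero] at h0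
      exact one_ne_zero h0
    · rw [hw, map_one] at him
      exact one_ne_zero him
  have hstar : quadraticEval φ hc (star w) = -(φ w.im * (1 + 2 * c)) := by
    simp only [quadraticEval_apply, QuadraticAlgebra.re_star, QuadraticAlgebra.im_star, map_add,
      map_mul, map_neg, map_one]
    linear_combination h0
  rw [hstar]
  exact neg_ne_zero.mpr (mul_ne_zero him hsep)

theorem exists_primitive_mul {K : Type*} [Field K] (A : ValuationSubring K) (a b : K) :
    ∃ (t : K) (a' b' : A), a = t * a' ∧ b = t * b' ∧ (a' = 1 ∨ b' = 1) := by
  wlog hab : A.valuation a ≤ A.valuation b generalizing a b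
  · obtain ⟨t, b', a', hb, ha, h⟩ := this b a (le_of_not_ge hab)
    exact ⟨t, a', b', ha, hb, h.symm⟩
  obtain ⟨s, hs⟩ := (A.valuation_le_iff a b).mp hab
  exact ⟨b, s, 1, by rw [← hs, mul_comm], (mul_one b).symm, Or.inr rfl⟩

namespace IsArtinSchreierGenerator

variable {K L F : Type*} [Field K] [Field L] [Field F] {f : K →+* L} {u : K} {y : L}
  {P : Place K F} {c : F}

theorem eq_zero_of_add_mul_eq_zero (hnotMem : y ∉ f.range) {a b : K} (h : f a + f b * y = 0) :
    a = 0 ∧ b = 0 := by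
  have hb : b = 0 := by
    by_contra hb
    refine hnotMem ⟨-(a / b), ?_⟩
    have hfb : f b ≠ 0 := (map_ne_zero f).mpr hb
    rw [map_neg, map_div₀]
    field_simp
    linear_combination -h
  rw [hb, map_zero, zero_mul, add_zero, map_eq_zero] at h
  exact ⟨h, hb⟩

/-- Scale `z` so that its coefficients become coprime; if the result vanishes at `c`, then its
conjugate does not, the equation `y² + y = u` being separable. -/
theorem exists_fraction_quadraticEval (hgen : ∀ z, ∃ a b, z = f a + f b * y) {u : P.ring}
    (hy : y ^ 2 + y = (f.comp P.ring.subtype) u) (hc : c ^ 2 + c = P.eval u) (hsep : 1 + 2 * c ≠ 0)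
    (z : L) : ∃ r s, z * quadraticEval (f.comp P.ring.subtype) hy s =
      quadraticEval (f.comp P.ring.subtype) hy r ∧
      (quadraticEval P.eval hc r ≠ 0 ∨ quadraticEval P.eval hc s ≠ 0) := by
  have hκ (t : P.ring) : quadraticEval (f.comp P.ring.subtype) hy
      (algebraMap P.ring (QuadraticAlgebra P.ring u (-1)) t) = f t := by
    simp only [quadraticEval_apply, QuadraticAlgebra.algebraMap_re, QuadraticAlgebra.algebraMap_im,
      map_zero, zero_mul, add_zero, RingHom.comp_apply, ValuationSubring.subtype_apply]
  obtain ⟨a, b, rfl⟩ := hgen z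
  obtain ⟨t, a', b', rfl, rfl, hprim⟩ := exists_primitive_mul P.ring a b
  set w : QuadraticAlgebra P.ring u (-1) := ⟨a', b'⟩ with hw
  have hz : f (t * a') + f (t * b') * y =
      f t * quadraticEval (f.comp P.ring.subtype) hy w := by
    simp only [quadraticEval_apply, hw, map_mul, RingHom.comp_apply, ValuationSubring.subtype_apply]
    ring
  by_cases h0 : quadraticEval P.eval hc w = 0
  · refine Place.exists_fraction_of_mul_eq hκ (t := t * w.norm) (r := 1) (s := star w) ?_ ?_
      (quadraticEval_star_ne_zero P.eval hc hsep hprim h0)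
    · rw [hz, mul_assoc, ← map_mul, ← QuadraticAlgebra.algebraMap_norm_eq_mul_star, hκ, map_one,
        mul_one, ← map_mul]
    · rw [map_one]
      exact one_ne_zero
  · refine Place.exists_fraction_of_mul_eq hκ (t := t) (r := w) (s := 1) ?_ h0 ?_
    · rw [map_one, mul_one, hz]
    · rw [map_one]
      exact one_ne_zero

theorem existsUnique_place_comap_eq_of_hasValue (hy : IsArtinSchreierGenerator f u y)
    (hnotMem : y ∉ f.range) {d : F} (hu : P.HasValue u d) (hc : c ^ 2 + c = d)
    (hsep : 1 + 2 * c ≠ 0) : ∃! Q : Place L F, Q.comap f = P ∧ Q.HasValue y c := by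
  obtain ⟨hu, rfl⟩ := hu
  have hyu : y ^ 2 + y = (f.comp P.ring.subtype) ⟨u, hu⟩ := hy.sq_add_self
  have hfrac := exists_fraction_quadraticEval hy.exists_eq_add_mul hyu hc hsep
  have hiff : ∀ Q : Place L F, (Q.comap f = P ∧ Q.HasValue y c) ↔
      ∀ w, Q.HasValue (quadraticEval (f.comp P.ring.subtype) hyu w)
        (quadraticEval P.eval hc w) := by
    refine fun Q => ⟨fun ⟨hQ, hQy⟩ w => ?_, fun hQ => ⟨?_, ?_⟩⟩
    · have hcomap := Place.comap_eq_iff.mp hQ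
      exact (hcomap _ _ (P.hasValue_coe w.re)).add ((hcomap _ _ (P.hasValue_coe w.im)).mul hQy)
    · refine Place.comap_eq_iff.mpr fun a d ⟨ha, hd⟩ => ?_
      simpa [quadraticEval_apply, hd] using hQ ⟨⟨a, ha⟩, 0⟩
    · simpa [quadraticEval_apply] using hQ ⟨0, 1⟩
  have hker : ∀ w, quadraticEval (f.comp P.ring.subtype) hyu w = 0 →
      quadraticEval P.eval hc w = 0 := by
    intro w hw
    obtain ⟨hre, him⟩ := eq_zero_of_add_mul_eq_zero hnotMem hw
    obtain rfl : w = 0 := QuadraticAlgebra.ext (Subtype.ext hre) (Subtype.ext him)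
    exact map_zero _
  simp only [hiff]
  exact existsUnique_of_exists_of_unique (Place.exists_of_fractions hker hfrac)
    fun _ _ => Place.eq_of_fractions hfrac

end IsArtinSchreierGenerator

theorem Place.exists_hasValue_of_sq_add_self {K F : Type*} [Field K] [Field F] {P : Place K F}
    {y : K} {d : F} (h : P.HasValue (y ^ 2 + y) d) : ∃ c, P.HasValue y c ∧ c ^ 2 + c = d := by
  obtain ⟨c, hc⟩ : ∃ c, P.HasValue y c := by
    rcases eq_or_ne y 0 with rfl | hy
    · exact ⟨0, hasValue_zero⟩
    refine (P.exists_hasValue_or_inv y).resolve_right fun hinv => ?_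
    have hprod : (y ^ 2 + y) * (y⁻¹ * y⁻¹) = 1 + y⁻¹ := by field_simp
    have hval := h.mul (hinv.mul hinv)
    rw [hprod, mul_zero, mul_zero] at hval
    have hval' := hasValue_one.add hinv
    rw [add_zero] at hval'
    exact one_ne_zero (hval'.unique hval)
  refine ⟨c, hc, ?_⟩
  rw [sq] at h ⊢
  exact ((hc.mul hc).add hc).unique h

theorem IsArtinSchreierGenerator.card_place_comap_eq_of_hasValue {K L F : Type*} [Field K]
    [Field L] [Field F] {f : K →+* L} {u : K} {y : L} {P : Place K F} {c d : F}
    (hy : IsArtinSchreierGenerator f u y) (hnotMem : y ∉ f.range) (hu : P.HasValue u d)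
    (hc : c ^ 2 + c = d) (hsep : 1 + 2 * c ≠ 0) :
    Nat.card {Q : Place L F // Q.comap f = P} = 2 := by
  have hc' : (-1 - c) ^ 2 + (-1 - c) = d := by linear_combination hc
  have hsep' : 1 + 2 * (-1 - c) ≠ 0 := fun h => hsep (by linear_combination -h)
  obtain ⟨Q, ⟨hQ, hQc⟩, hQu⟩ := hy.existsUnique_place_comap_eq_of_hasValue hnotMem hu hc hsep
  obtain ⟨Q', ⟨hQ', hQc'⟩, hQu'⟩ := hy.existsUnique_place_comap_eq_of_hasValue hnotMem hu hc' hsep'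
  have hne : Q ≠ Q' := by
    rintro rfl
    exact hsep (by linear_combination hQc.unique hQc')
  have hpair : {R : Place L F | R.comap f = P} = {Q, Q'} := by
    ext R
    refine ⟨fun hR => ?_, ?_⟩
    · obtain ⟨b, hb, hbd⟩ : ∃ b, R.HasValue y b ∧ b ^ 2 + b = d := by
        refine Place.exists_hasValue_of_sq_add_self ?_
        rw [hy.sq_add_self]
        exact Place.comap_eq_iff.mp hR u d hu
      have hroots : (b - c) * (b - (-1 - c)) = 0 := by linear_combination hbd - hc
      rcases mul_eq_zero.mp hroots with h | h
      · exact Or.inl (hQu R ⟨hR, sub_eq_zero.mp h ▸ hb⟩)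
      · exact Or.inr (hQu' R ⟨hR, sub_eq_zero.mp h ▸ hb⟩)
    · rintro (rfl | rfl)
      exacts [hQ, hQ']
  rw [← Set.ncard_pair hne, ← hpair]
  rfl

section RationalFunctionField

open Polynomial IntermediateField

variable {k K F : Type*} [Field k] [Field K] [Field F] [Algebra k K] [Algebra k F] {t : K}

theorem exists_isCoprime_mul_aeval_eq (ht : Transcendental k t) (htop : k⟮t⟯ = ⊤) (z : K) :
    ∃ r s : k[X], IsCoprime r s ∧ s ≠ 0 ∧ z * aeval t s = aeval t r := by
  let e := RatFunc.algEquivOfTranscendental t ht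
  obtain ⟨q, hq⟩ := e.surjective ⟨z, htop ▸ mem_top⟩
  refine ⟨q.num, q.denom, q.isCoprime_num_denom, q.denom_ne_zero, ?_⟩
  have hdenom : aeval t q.denom ≠ 0 := fun h => q.denom_ne_zero (transcendental_iff.mp ht _ h)
  have hz : z = aeval t q.num / aeval t q.denom := by
    rw [← RatFunc.algEquivOfTranscendental_apply t ht]
    exact (congrArg Subtype.val hq).symm
  rw [hz, div_mul_cancel₀ _ hdenom]

theorem adjoin_simple_inv_eq_top (htop : k⟮t⟯ = ⊤) : k⟮t⁻¹⟯ = ⊤ := by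
  rw [eq_top_iff, ← htop, adjoin_simple_le_iff]
  simpa only [inv_inv] using inv_mem (mem_adjoin_simple_self k t⁻¹)

namespace Place

variable {Q : Place K F}

theorem HasValue.aeval {a : F} (hk : ∀ x : k, Q.HasValue (algebraMap k K x) (algebraMap k F x))
    (ht : Q.HasValue t a) (p : k[X]) : Q.HasValue (aeval t p) (aeval a p) := by
  induction p using Polynomial.induction_on with
  | C x => simpa only [aeval_C] using hk x
  | add p q hp hq => simpa only [map_add] using hp.add hq
  | monomial n x h => simpa only [pow_succ, ← mul_assoc, map_mul, aeval_X] using h.mul ht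

theorem existsUnique_hasValue_of_adjoin_eq_top (ht : Transcendental k t) (htop : k⟮t⟯ = ⊤) (a : F) :
    ∃! Q : Place K F, (∀ x : k, Q.HasValue (algebraMap k K x) (algebraMap k F x)) ∧
      Q.HasValue t a := by
  have hiff : ∀ Q : Place K F, ((∀ x : k, Q.HasValue (algebraMap k K x) (algebraMap k F x)) ∧
      Q.HasValue t a) ↔ ∀ p : k[X], Q.HasValue (aeval t p) (aeval a p) :=
    fun Q => ⟨fun h => HasValue.aeval h.1 h.2, fun h =>
      ⟨fun x => by simpa only [aeval_C] using h (C x), by simpa only [aeval_X] using h X⟩⟩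
  have hker (p : k[X]) (hp : aeval t p = 0) : aeval a p = 0 := by
    rw [transcendental_iff.mp ht p hp, map_zero]
  have hfrac (z : K) : ∃ r s : k[X], z * aeval t s = aeval t r ∧
      (aeval a r ≠ 0 ∨ aeval a s ≠ 0) := by
    obtain ⟨r, s, ⟨p, q, hpq⟩, -, hz⟩ := exists_isCoprime_mul_aeval_eq ht htop z
    refine ⟨r, s, hz, ?_⟩
    by_contra! h
    simpa [h.1, h.2] using congrArg (aeval a) hpq
  simp only [hiff]
  exact existsUnique_of_exists_of_unique (exists_of_fractions hker hfrac)
    fun _ _ => eq_of_fractions hfrac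

theorem exists_valuation_aeval_eq_pow
    (hk : ∀ x : k, Q.HasValue (algebraMap k K x) (algebraMap k F x))
    (ht : Q.HasValue t 0) {p : k[X]} (hp : p ≠ 0) :
    ∃ n : ℕ, Q.ring.valuation (aeval t p) = Q.ring.valuation t ^ n := by
  obtain ⟨q, hq, hdvd⟩ := exists_eq_pow_rootMultiplicity_mul_and_not_dvd p hp 0
  generalize p.rootMultiplicity 0 = n at hq
  rw [C_0, sub_zero] at hq hdvd
  have hq0 : aeval (0 : F) q ≠ 0 := by
    rw [← coeff_zero_eq_aeval_zero']
    exact (_root_.map_ne_zero _).mpr (X_dvd_iff.not.mp hdvd)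
  refine ⟨n, ?_⟩
  rw [hq, map_mul, map_pow, aeval_X, map_mul, map_pow,
    (HasValue.aeval hk ht q).valuation_eq_one hq0, mul_one]

theorem hasSimplePole_inv_of_hasValue_zero (htr : Transcendental k t) (htop : k⟮t⟯ = ⊤)
    (hk : ∀ x : k, Q.HasValue (algebraMap k K x) (algebraMap k F x)) (ht : Q.HasValue t 0) :
    HasSimplePole Q.ring.valuation t⁻¹ := by
  have ht0 : 0 < Q.ring.valuation t := (Valuation.pos_iff _).mpr (by
    rintro rfl
    exact htr isAlgebraic_zero)
  refine ⟨by rw [map_inv₀, one_lt_inv₀ ht0]; exact hasValue_zero_iff.mp ht, fun z hz => ?_⟩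
  obtain ⟨r, s, -, hs, hrs⟩ := exists_isCoprime_mul_aeval_eq htr htop z
  have hr : r ≠ 0 := by
    rintro rfl
    rw [map_zero, mul_eq_zero] at hrs
    exact hs (transcendental_iff.mp htr s (hrs.resolve_left hz))
  obtain ⟨m, hm⟩ := exists_valuation_aeval_eq_pow hk ht hr
  obtain ⟨n, hn⟩ := exists_valuation_aeval_eq_pow hk ht hs
  have hmn := congrArg Q.ring.valuation hrs
  rw [map_mul, hm, hn] at hmn
  refine ⟨n - m, ?_⟩
  rw [eq_div_of_mul_eq (pow_ne_zero n ht0.ne') hmn, map_inv₀, inv_zpow', neg_sub,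
    zpow_sub₀ ht0.ne', zpow_natCast, zpow_natCast]

end Place

end RationalFunctionField

theorem card_subtype_comp {A B : Type*} (φ : A → B) (p : B → Prop) {n : ℕ} (hn : n ≠ 0)
    (h : ∀ b, p b → Nat.card {a // φ a = b} = n) :
    Nat.card {a // p (φ a)} = Nat.card {b // p b} * n := by
  have fiberEquiv : ∀ b : {b // p b}, {a // φ a = b} ≃ Fin n := fun b =>
    (Nat.equivFinOfCardPos (by rwa [h b b.2])).trans (finCongr (h b b.2))
  have e : {a // p (φ a)} ≃ {b // p b} × Fin n :=
    ((Equiv.sigmaSubtypeFiberEquivSubtype φ fun _ => Iff.rfl).symm.trans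
      (Equiv.sigmaCongrRight fiberEquiv)).trans (Equiv.sigmaEquivProd _ _)
  rw [Nat.card_congr e, Nat.card_prod, Nat.card_fin]

section FieldWithEightElements

theorem finite_of_card_eq_eight {F : Type*} (hF : Nat.card F = 8) : Finite F :=
  Nat.finite_of_card_ne_zero (by rw [hF]; decide)

variable {F : Type*} [Field F] (hF : Nat.card F = 8)

include hF

theorem charP_two_of_card_eq_eight : CharP F 2 := by
  have := finite_of_card_eq_eight hF
  have := Fintype.ofFinite F
  exact charP_of_card_eq_prime_pow (f := 3) (by rw [← Nat.card_eq_fintype_card, hF]; norm_num)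

theorem pow_seven_eq_one_of_card_eq_eight {a : F} (ha : a ≠ 0) : a ^ 7 = 1 := by
  have := finite_of_card_eq_eight hF
  have := Fintype.ofFinite F
  have h := FiniteField.pow_card_sub_one_eq_one a ha
  rwa [← Nat.card_eq_fintype_card, hF] at h

theorem eq_one_of_pow_three_eq_one {a : F} (h : a ^ 3 = 1) : a = 1 := by
  have ha : a ≠ 0 := by
    rintro rfl
    simp at h
  linear_combination pow_seven_eq_one_of_card_eq_eight hF ha - (a ^ 4 + a) * h

theorem trace_add_one_add_inv_eq_zero {a d : F} (ha : a ≠ 0) (ha1 : a ≠ 1)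
    (hd : d = a + 1 + 1 / a) : d ^ 4 + d ^ 2 + d = 0 := by
  have := charP_two_of_card_eq_eight hF
  have h7 := pow_seven_eq_one_of_card_eq_eight hF ha
  have hsum : a ^ 6 + a ^ 5 + a ^ 4 + a ^ 3 + a ^ 2 + a + 1 = 0 := by
    refine (mul_eq_zero.mp ?_).resolve_left (sub_ne_zero.mpr ha1)
    linear_combination h7
  have hinv : 1 / a = a ^ 6 := by
    rw [div_eq_iff ha]
    linear_combination -h7
  have hd2 : d ^ 2 = a ^ 2 + 1 + a ^ 5 := by
    rw [hd, hinv, CharTwo.add_sq, CharTwo.add_sq]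
    linear_combination a ^ 5 * h7
  have hd4 : d ^ 4 = a ^ 4 + 1 + a ^ 3 := by
    rw [show d ^ 4 = (d ^ 2) ^ 2 by ring, hd2, CharTwo.add_sq, CharTwo.add_sq]
    linear_combination a ^ 3 * h7
  rw [hd4, hd2, hd, hinv]
  linear_combination hsum + CharTwo.two_eq_zero (R := F)

/-- Additive Hilbert 90 with an explicit solution: an element `d` of trace zero is `c² + c` for
`c = d²`. -/
theorem exists_sq_add_self_eq {a : F} (ha : a ≠ 0) (ha1 : a ≠ 1) :
    ∃ c : F, c ^ 2 + c = a + 1 + 1 / a := by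
  have := charP_two_of_card_eq_eight hF
  refine ⟨(a + 1 + 1 / a) ^ 2, ?_⟩
  linear_combination trace_add_one_add_inv_eq_zero hF ha ha1 rfl -
    (a + 1 + 1 / a) * CharTwo.two_eq_zero (R := F)

theorem add_one_add_inv_ne_zero {a : F} (ha : a ≠ 0) (ha1 : a ≠ 1) : a + 1 + 1 / a ≠ 0 := by
  intro h
  field_simp at h
  exact ha1 (eq_one_of_pow_three_eq_one hF (by linear_combination (a - 1) * h))

theorem ne_zero_and_ne_one_of_sq_add_self_eq {a c : F} (ha : a ≠ 0) (ha1 : a ≠ 1)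
    (hc : c ^ 2 + c = a + 1 + 1 / a) : c ≠ 0 ∧ c ≠ 1 := by
  have := charP_two_of_card_eq_eight hF
  have hne := hc.trans_ne (add_one_add_inv_ne_zero hF ha ha1)
  refine ⟨?_, ?_⟩ <;> rintro rfl <;> apply hne
  · ring
  · rw [one_pow, CharTwo.add_self_eq_zero]

theorem sq_add_self_ne_one (c : F) : c ^ 2 + c ≠ 1 := by
  intro h
  have := charP_two_of_card_eq_eight hF
  have hc3 : c ^ 3 = 1 := by
    linear_combination (c - 1) * h + (c - 1) * CharTwo.two_eq_zero (R := F)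
  rw [eq_one_of_pow_three_eq_one hF hc3, one_pow, CharTwo.add_self_eq_zero] at h
  exact zero_ne_one h

theorem card_ne_zero_and_ne_one : Nat.card {a : F // a ≠ 0 ∧ a ≠ 1} = 6 := by
  have := finite_of_card_eq_eight hF
  have hcompl : ({0, 1}ᶜ : Set F).ncard = 6 := by
    rw [Set.ncard_compl, hF, Set.ncard_pair zero_ne_one]
  rw [← hcompl, ← Nat.card_coe_set_eq]
  refine Nat.card_congr (Equiv.subtypeEquivRight fun a => ?_)
  rw [Set.mem_compl_iff, Set.mem_insert_iff, Set.mem_singleton_iff, not_or]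

end FieldWithEightElements

namespace ArtinSchreierTower

section FunctionFields

theorem coe_pullback {l i : ℕ} (h : l ≤ i) (a : functionField l) :
    (pullback h a : Ambient) = a :=
  IntermediateField.coe_inclusion (functionField_mono h) a

theorem pullback_coordFun {l i : ℕ} (h : l ≤ i) (j : Fin (l + 1)) :
    pullback h (coordFun l j) = coordFun i (Fin.castLE (Nat.succ_le_succ h) j) :=
  Subtype.ext (coe_pullback h _)

theorem pullback_pullback {k l i : ℕ} (h : k ≤ l) (h' : l ≤ i) (a : functionField k) :
    pullback h' (pullback h a) = pullback (h.trans h') a :=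
  Subtype.ext (by simp only [coe_pullback])

theorem pullback_self {i : ℕ} (h : i ≤ i) (a : functionField i) : pullback h a = a :=
  Subtype.ext (coe_pullback h a)

/-- The right-hand side `xᵢ + 1 + 1/xᵢ` of the equation of `xᵢ₊₁`, as a function on `Cᵢ`. -/
noncomputable def rhs (i : ℕ) : functionField i :=
  coordFun i (Fin.last i) + 1 + 1 / coordFun i (Fin.last i)

theorem exists_eq_add_mul_x {i : ℕ} {z : Ambient} (hz : z ∈ functionField (i + 1)) :
    ∃ a ∈ functionField i, ∃ b ∈ functionField i, z = a + b * x (i + 1) := by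
  have hx : ∀ j ≤ i, x j ∈ functionField i := fun j hj =>
    IntermediateField.subset_adjoin _ _ ⟨j, hj, rfl⟩
  have hz' : z ∈ Algebra.adjoin (RatFunc (ZMod 2)) (x '' Set.Iic (i + 1)) := by
    rwa [← IntermediateField.adjoin_toSubalgebra_of_isAlgebraic fun w _ =>
      Algebra.IsAlgebraic.isAlgebraic w]
  clear hz
  induction hz' using Algebra.adjoin_induction with
  | mem w hw =>
    obtain ⟨j, hj, rfl⟩ := hw
    rcases Nat.le_succ_iff.mp (Set.mem_Iic.mp hj) with hj | rfl
    · exact ⟨x j, hx j hj, 0, zero_mem _, by ring⟩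
    · exact ⟨0, zero_mem _, 1, one_mem _, by ring⟩
  | algebraMap r => exact ⟨_, (functionField i).algebraMap_mem r, 0, zero_mem _, by ring⟩
  | add v w _ _ hv hw =>
    obtain ⟨a, ha, b, hb, rfl⟩ := hv
    obtain ⟨a', ha', b', hb', rfl⟩ := hw
    exact ⟨a + a', add_mem ha ha', b + b', add_mem hb hb', by ring⟩
  | mul v w _ _ hv hw =>
    obtain ⟨a, ha, b, hb, rfl⟩ := hv
    obtain ⟨a', ha', b', hb', rfl⟩ := hw
    refine ⟨a * a' + b * b' * rhs i,
      add_mem (mul_mem ha ha') (mul_mem (mul_mem hb hb') (rhs i).2), a * b' + a' * b - b * b',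
      sub_mem (add_mem (mul_mem ha hb') (mul_mem ha' hb)) (mul_mem hb hb'), ?_⟩
    have hsq : x (i + 1) ^ 2 + x (i + 1) = rhs i := x_succ i
    linear_combination (b * b') * hsq

theorem isArtinSchreierGenerator (i : ℕ) : IsArtinSchreierGenerator (pullback i.le_succ) (rhs i)
    (coordFun (i + 1) (Fin.last _)) where
  sq_add_self := Subtype.ext (x_succ i)
  exists_eq_add_mul z := by
    obtain ⟨a, ha, b, hb, h⟩ := exists_eq_add_mul_x z.2
    exact ⟨⟨a, ha⟩, ⟨b, hb⟩, Subtype.ext h⟩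

theorem functionField_zero : functionField 0 = ⊥ := by
  rw [functionField, IntermediateField.adjoin_eq_bot_iff]
  rintro _ ⟨j, hj, rfl⟩
  obtain rfl : j = 0 := Nat.le_zero.mp hj
  exact IntermediateField.mem_bot.mpr ⟨_, rfl⟩

open IntermediateField

instance (i : ℕ) : Infinite (functionField i) :=
  have : Infinite (RatFunc (ZMod 2)) :=
    .of_injective _ (RatFunc.algebraMap_injective (ZMod 2))
  .of_injective _ (algebraMap (RatFunc (ZMod 2)) (functionField i)).injective

theorem transcendental_coordFun_zero : Transcendental (ZMod 2) (coordFun 0 0) :=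
  (transcendental_algebraMap_iff (algebraMap (RatFunc (ZMod 2)) (functionField 0)).injective).mpr
    RatFunc.transcendental_X

theorem adjoin_coordFun_zero : (ZMod 2)⟮coordFun 0 0⟯ = ⊤ := by
  let f := IsScalarTower.toAlgHom (ZMod 2) (RatFunc (ZMod 2)) (functionField 0)
  have hf : Function.Surjective f := fun z => by
    obtain ⟨r, hr⟩ := mem_bot.mp (functionField_zero.le z.2)
    exact ⟨r, Subtype.ext hr⟩
  have hmap := congrArg (IntermediateField.map f) (RatFunc.adjoin_X (K := ZMod 2))
  rwa [adjoin_map, Set.image_singleton, ← AlgHom.fieldRange_eq_map,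
    AlgHom.fieldRange_eq_top.mpr hf] at hmap

end FunctionFields

section Ramified

variable {F Γ : Type*} [Field F] [LinearOrderedCommGroupWithZero Γ]

theorem comap_pullback_pullback {k l i : ℕ} (h : k ≤ l) (h' : l ≤ i)
    (Q : Place (functionField i) F) :
    (Q.comap (pullback h')).comap (pullback h) = Q.comap (pullback (h.trans h')) :=
  Place.ext_of_hasValue fun z c hz => by
    rw [Place.hasValue_comap, Place.hasValue_comap, pullback_pullback] at hz
    exact Place.hasValue_comap.mpr hz

theorem comap_pullback_self {i : ℕ} (h : i ≤ i) (Q : Place (functionField i) F) :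
    Q.comap (pullback h) = Q :=
  Place.ext_of_hasValue fun z c hz => by rwa [Place.hasValue_comap, pullback_self] at hz

theorem valuation_comap_pullback_pullback {k l i : ℕ} (h : k ≤ l) (h' : l ≤ i)
    (v : Valuation (functionField i) Γ) :
    (v.comap (pullback h')).comap (pullback h) = v.comap (pullback (h.trans h')) :=
  Valuation.ext fun z => by simp only [Valuation.comap_apply, pullback_pullback]

theorem valuation_rhs {i : ℕ} {v : Valuation (functionField i) Γ}
    (hv : 1 < v (coordFun i (Fin.last i))) : v (rhs i) = v (coordFun i (Fin.last i)) :=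
  valuation_add_one_add_inv hv

theorem hasSimplePole_rhs {i : ℕ} {v : Valuation (functionField i) Γ}
    (hv : HasSimplePole (v.comap (pullback i.zero_le)) (rhs 0)) : HasSimplePole v (rhs i) := by
  induction i with
  | zero =>
    convert hv
    ext z
    rw [Valuation.comap_apply, pullback_self]
  | succ i ih =>
    rw [← valuation_comap_pullback_pullback i.zero_le i.le_succ] at hv
    have hx := (isArtinSchreierGenerator i).hasSimplePole (ih hv)
    exact hx.of_valuation_eq (valuation_rhs hx.one_lt).symm

theorem hasSimplePole_rhs_comap_succ {i : ℕ} {v : Valuation (functionField (i + 1)) Γ}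
    (hv : HasSimplePole (v.comap (pullback (i + 1).zero_le)) (rhs 0)) :
    HasSimplePole (v.comap (pullback i.le_succ)) (rhs i) :=
  hasSimplePole_rhs (by rwa [valuation_comap_pullback_pullback])

theorem valuation_pullback_rhs_zero {i : ℕ} {v : Valuation (functionField i) Γ}
    (hv : HasSimplePole (v.comap (pullback i.zero_le)) (rhs 0)) :
    v (pullback i.zero_le (rhs 0)) = v (rhs i) ^ 2 ^ i := by
  induction i with
  | zero => rw [pullback_self, pow_zero, pow_one]
  | succ i ih =>
    have hstep := hasSimplePole_rhs_comap_succ hv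
    rw [← valuation_comap_pullback_pullback i.zero_le i.le_succ] at hv
    have ih := ih hv
    simp only [Valuation.comap_apply, pullback_pullback] at ih
    rw [ih, (isArtinSchreierGenerator i).valuation_map_eq_sq hstep,
      valuation_rhs ((isArtinSchreierGenerator i).one_lt_valuation hstep), ← pow_mul, pow_succ']

theorem one_lt_valuation_coordFun {i : ℕ} {v : Valuation (functionField i) Γ}
    (hv : HasSimplePole (v.comap (pullback i.zero_le)) (rhs 0)) {j : Fin (i + 1)} (hj : j ≠ 0) :
    1 < v (coordFun i j) := by
  induction i with
  | zero => exact absurd (Subsingleton.elim (α := Fin 1) j 0) hj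
  | succ i ih =>
    induction j using Fin.lastCases with
    | last =>
      exact (isArtinSchreierGenerator i).one_lt_valuation (hasSimplePole_rhs_comap_succ hv)
    | cast j =>
      rw [← valuation_comap_pullback_pullback i.zero_le i.le_succ] at hv
      have hj0 : j ≠ 0 := by
        rintro rfl
        exact hj rfl
      have := ih hv hj0
      rwa [Valuation.comap_apply, pullback_coordFun] at this

theorem existsUnique_place_comap_eq {P : Place (functionField 0) F}
    (hP : HasSimplePole P.ring.valuation (rhs 0)) (i : ℕ) :
    ∃! Q : Place (functionField i) F, Q.comap (pullback i.zero_le) = P := by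
  induction i with
  | zero => simp only [comap_pullback_self, existsUnique_eq]
  | succ i ih =>
    obtain ⟨R, hR, hRu⟩ := ih
    have hrhs : HasSimplePole R.ring.valuation (rhs i) := by
      rw [← hR] at hP
      exact hasSimplePole_rhs (hP.of_isEquiv (isEquiv_valuation_comap _ _).symm)
    obtain ⟨Q, hQ, hQu⟩ :=
      (isArtinSchreierGenerator i).existsUnique_place_comap_eq_of_hasSimplePole hrhs
    simp only [← comap_pullback_pullback i.zero_le i.le_succ]
    exact ⟨Q, (congrArg _ hQ).trans hR, fun Q' hQ' => hQu Q' (hRu _ hQ')⟩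

end Ramified

section Base

theorem hasValue_algebraMap_zmod_two {K F : Type*} [Field K] [Field F]
    [Algebra (ZMod 2) K] [Algebra (ZMod 2) F] (P : Place K F) (a : ZMod 2) :
    P.HasValue (algebraMap (ZMod 2) K a) (algebraMap (ZMod 2) F a) := by
  obtain rfl | rfl : a = 0 ∨ a = 1 := by decide +revert
  · rw [map_zero, map_zero]
    exact Place.hasValue_zero
  · rw [map_one, map_one]
    exact Place.hasValue_one

variable {F : Type*} [Field F] [CharP F 2] {P : Place (functionField 0) F}

theorem existsUnique_place_hasValue_coordFun_zero (a : F) :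
    ∃! P : Place (functionField 0) F, P.HasValue (coordFun 0 0) a := by
  let _ := ZMod.algebra F 2
  simpa only [hasValue_algebraMap_zmod_two, implies_true, true_and] using
    Place.existsUnique_hasValue_of_adjoin_eq_top transcendental_coordFun_zero adjoin_coordFun_zero a

theorem transcendental_coordFun_zero_inv : Transcendental (ZMod 2) (coordFun 0 0)⁻¹ :=
  mt IsAlgebraic.inv_iff.mp transcendental_coordFun_zero

theorem existsUnique_place_hasValue_coordFun_zero_inv :
    ∃! P : Place (functionField 0) F, P.HasValue (coordFun 0 0)⁻¹ 0 := by
  let _ := ZMod.algebra F 2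
  simpa only [hasValue_algebraMap_zmod_two, implies_true, true_and] using
    Place.existsUnique_hasValue_of_adjoin_eq_top transcendental_coordFun_zero_inv
      (adjoin_simple_inv_eq_top adjoin_coordFun_zero) (0 : F)

theorem hasSimplePole_rhs_zero_of_hasValue_inv (hP : P.HasValue (coordFun 0 0)⁻¹ 0) :
    HasSimplePole P.ring.valuation (rhs 0) := by
  let _ := ZMod.algebra F 2
  have hpole := Place.hasSimplePole_inv_of_hasValue_zero transcendental_coordFun_zero_inv
    (adjoin_simple_inv_eq_top adjoin_coordFun_zero) (hasValue_algebraMap_zmod_two P) hP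
  rw [inv_inv] at hpole
  exact hpole.of_valuation_eq (valuation_rhs hpole.one_lt).symm

theorem hasSimplePole_rhs_zero_of_hasValue (hP : P.HasValue (coordFun 0 0) 0) :
    HasSimplePole P.ring.valuation (rhs 0) := by
  let _ := ZMod.algebra F 2
  have hpole := Place.hasSimplePole_inv_of_hasValue_zero transcendental_coordFun_zero
    adjoin_coordFun_zero (hasValue_algebraMap_zmod_two P) hP
  refine hpole.of_valuation_eq ?_
  have hsymm : rhs 0 = (coordFun 0 0)⁻¹ + 1 + 1 / (coordFun 0 0)⁻¹ := by
    rw [one_div, inv_inv, rhs, one_div, Fin.last_zero]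
    ring
  rw [hsymm, valuation_add_one_add_inv hpole.one_lt]

end Base

section Degree

theorem coordFun_last_notMem_range (i : ℕ) :
    coordFun (i + 1) (Fin.last _) ∉ (pullback i.le_succ).range := by
  obtain ⟨P, hP, -⟩ := existsUnique_place_hasValue_coordFun_zero (0 : ZMod 2)
  have hpole := hasSimplePole_rhs_zero_of_hasValue hP
  obtain ⟨B, hB⟩ := exists_valuationSubring_comap_eq (pullback (i + 1).zero_le) P.ring
  rw [← hB] at hpole
  exact (isArtinSchreierGenerator i).notMem_range
    (hasSimplePole_rhs_comap_succ (hpole.of_isEquiv (isEquiv_valuation_comap _ B).symm))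

theorem coverDegree_succ (i : ℕ) : coverDegree i (i + 1) = 2 := by
  have hle := functionField_mono i.le_succ
  rw [coverDegree, IntermediateField.relfinrank_eq_finrank_of_le hle]
  let y : IntermediateField.extendScalars hle := ⟨x (i + 1), (coordFun (i + 1) (Fin.last _)).2⟩
  have hli : LinearIndependent (functionField i) ![1, y] := by
    refine LinearIndependent.pair_iff.mpr fun a b hab => ?_
    refine IsArtinSchreierGenerator.eq_zero_of_add_mul_eq_zero (coordFun_last_notMem_range i)
      (Subtype.ext ?_)
    have hab' : (a : Ambient) * 1 + b * x (i + 1) = 0 := congrArg Subtype.val hab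
    rwa [mul_one] at hab'
  have hspan : ⊤ ≤ Submodule.span (functionField i) (Set.range ![1, y]) := by
    intro z _
    obtain ⟨a, ha, b, hb, h⟩ := exists_eq_add_mul_x (i := i) z.2
    rw [Matrix.range_cons_cons_empty, Submodule.mem_span_pair]
    refine ⟨⟨a, ha⟩, ⟨b, hb⟩, Subtype.ext ?_⟩
    change a * 1 + b * x (i + 1) = z
    rw [h, mul_one]
  rw [Module.finrank_eq_card_basis (Module.Basis.mk hli hspan), Fintype.card_fin]

theorem coverDegree_zero (i : ℕ) : coverDegree 0 i = 2 ^ i := by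
  induction i with
  | zero => simp [coverDegree]
  | succ i ih =>
    rw [pow_succ, ← ih, ← coverDegree_succ i]
    exact (IntermediateField.relfinrank_mul_relfinrank (functionField_mono i.zero_le)
      (functionField_mono i.le_succ)).symm

end Degree

theorem ClosedPoint.ramificationIdx_eq_of_valuation_eq_pow {l i : ℕ} (h : l ≤ i) (Q : ClosedPoint i)
    {u : functionField l} {w : functionField i}
    (hu : HasSimplePole (Q.proj h).localRing.valuation u)
    (hw : HasSimplePole Q.localRing.valuation w) {e : ℕ}
    (huw : Q.localRing.valuation (pullback h u) = Q.localRing.valuation w ^ e) :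
    Q.ramificationIdx h = e := by
  let _ : Algebra (Q.proj h).localRing Q.localRing := (Q.localMap h).toAlgebra
  change Ideal.ramificationIdx' (IsLocalRing.maximalIdeal (Q.proj h).localRing)
    (IsLocalRing.maximalIdeal Q.localRing) = e
  have hwmem : (⟨w⁻¹, hw.inv_mem⟩ : Q.localRing) ∈ IsLocalRing.maximalIdeal Q.localRing := by
    rw [hw.maximalIdeal_eq_span]
    exact Ideal.mem_span_singleton_self _
  have hw0 : w ≠ 0 := by
    rintro rfl
    simpa using hw.one_lt
  rw [hu.maximalIdeal_eq_span, hw.maximalIdeal_eq_span]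
  refine ramificationIdx_span_singleton (fun h0 => inv_ne_zero hw0 (congrArg Subtype.val h0))
    ((IsLocalRing.mem_maximalIdeal _).mp hwmem) (Associated.symm ?_)
  have hval : Q.localRing.valuation (pullback h u⁻¹) = Q.localRing.valuation (w⁻¹ ^ e) := by
    rw [map_inv₀, map_inv₀, huw, map_pow, map_inv₀, inv_pow]
  obtain ⟨a, ha⟩ := (ValuationSubring.valuation_eq_iff _ _ _).mp hval
  exact ⟨a, Subtype.ext ((mul_comm _ _).trans ha)⟩

theorem ClosedPoint.isTotallyRamified_of_hasSimplePole {i : ℕ} {Q : ClosedPoint i}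
    (hQ : HasSimplePole (Q.proj i.zero_le).localRing.valuation (rhs 0)) :
    Q.IsTotallyRamified i.zero_le := by
  have hv : HasSimplePole (Q.localRing.valuation.comap (pullback i.zero_le)) (rhs 0) :=
    hQ.of_isEquiv (isEquiv_valuation_comap _ _).symm
  rw [IsTotallyRamified, coverDegree_zero]
  exact Q.ramificationIdx_eq_of_valuation_eq_pow i.zero_le hQ (hasSimplePole_rhs hv)
    (valuation_pullback_rhs_zero hv)

section Split

variable {F : Type*} [Field F] {i : ℕ} {a : F}

theorem hasValue_rhs {P : Place (functionField i) F} (ha : P.HasValue (coordFun i (Fin.last i)) a)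
    (ha0 : a ≠ 0) : P.HasValue (rhs i) (a + 1 + 1 / a) :=
  (ha.add Place.hasValue_one).add (Place.hasValue_one.div ha ha0)

theorem exists_hasValue_coordFun_last_succ {Q : Place (functionField (i + 1)) F}
    (ha : (Q.comap (pullback i.le_succ)).HasValue (coordFun i (Fin.last i)) a) (ha0 : a ≠ 0) :
    ∃ c, Q.HasValue (coordFun (i + 1) (Fin.last _)) c ∧ c ^ 2 + c = a + 1 + 1 / a := by
  refine Place.exists_hasValue_of_sq_add_self ?_
  rw [(isArtinSchreierGenerator i).sq_add_self]
  exact Place.hasValue_comap.mp (hasValue_rhs ha ha0)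

variable (hF : Nat.card F = 8)

include hF

theorem exists_hasValue_coordFun_last {Q : Place (functionField i) F}
    (ha : Q.HasValue (coordFun i 0) a) (ha0 : a ≠ 0) (ha1 : a ≠ 1) :
    ∃ c, c ≠ 0 ∧ c ≠ 1 ∧ Q.HasValue (coordFun i (Fin.last i)) c := by
  induction i with
  | zero => exact ⟨a, ha0, ha1, ha⟩
  | succ i ih =>
    have ha' : (Q.comap (pullback i.le_succ)).HasValue (coordFun i 0) a := by
      rw [Place.hasValue_comap, pullback_coordFun]
      exact ha
    obtain ⟨b, hb0, hb1, hb⟩ := ih ha'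
    obtain ⟨c, hc, hcb⟩ := exists_hasValue_coordFun_last_succ hb hb0
    obtain ⟨hc0, hc1⟩ := ne_zero_and_ne_one_of_sq_add_self_eq hF hb0 hb1 hcb
    exact ⟨c, hc0, hc1, hc⟩

theorem card_place_comap_succ_eq {P : Place (functionField i) F} (ha : P.HasValue (coordFun i 0) a)
    (ha0 : a ≠ 0) (ha1 : a ≠ 1) :
    Nat.card {Q : Place (functionField (i + 1)) F // Q.comap (pullback i.le_succ) = P} = 2 := by
  have := charP_two_of_card_eq_eight hF
  obtain ⟨b, hb0, hb1, hb⟩ := exists_hasValue_coordFun_last hF ha ha0 ha1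
  obtain ⟨c, hc⟩ := exists_sq_add_self_eq hF hb0 hb1
  refine (isArtinSchreierGenerator i).card_place_comap_eq_of_hasValue
    (coordFun_last_notMem_range i) (hasValue_rhs hb hb0) hc ?_
  rw [CharTwo.two_eq_zero, zero_mul, add_zero]
  exact one_ne_zero

theorem card_place_comap_eq {P : Place (functionField 0) F} (ha : P.HasValue (coordFun 0 0) a)
    (ha0 : a ≠ 0) (ha1 : a ≠ 1) (i : ℕ) :
    Nat.card {Q : Place (functionField i) F // Q.comap (pullback i.zero_le) = P} = 2 ^ i := by
  induction i with
  | zero =>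
    simp only [comap_pullback_self]
    exact Nat.card_unique
  | succ i ih =>
    simp only [← comap_pullback_pullback i.zero_le i.le_succ]
    rw [card_subtype_comp (Place.comap (pullback i.le_succ))
      (fun R => R.comap (pullback i.zero_le) = P) two_ne_zero, ih, pow_succ]
    rintro R rfl
    rw [Place.hasValue_comap, pullback_coordFun] at ha
    exact card_place_comap_succ_eq hF ha ha0 ha1

end Split

namespace RationalPoint

variable {F : Type*} [Field F] {i : ℕ}

/-- The place of the function field given by a rational point. -/
def toPlace (P : RationalPoint i F) : Place (functionField i) F :=
  ⟨P.localRing, P.eval, P.isLocalHom_eval⟩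

/-- Over a finite field, the rational points are the places of the function field: no place is
trivial. -/
def equivPlace (i : ℕ) (F : Type*) [Field F] [Finite F] :
    RationalPoint i F ≃ Place (functionField i) F where
  toFun := toPlace
  invFun P := ⟨⟨P.ring, P.ring_ne_top⟩, P.eval, P.isLocalHom_eval⟩
  left_inv _ := rfl
  right_inv _ := rfl

theorem coord_eq_coe_iff (P : RationalPoint i F) (j : Fin (i + 1)) (c : F) :
    P.coord j = (c : OnePoint F) ↔ P.toPlace.HasValue (coordFun i j) c := by
  rw [coord]
  split_ifs with h
  · rw [OnePoint.coe_eq_coe]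
    exact ⟨fun hc => ⟨h, hc⟩, fun ⟨_, hc⟩ => hc⟩
  · exact ⟨fun hc => absurd hc (OnePoint.infty_ne_coe c), fun hc => absurd hc.mem h⟩

theorem coord_eq_infty_iff (P : RationalPoint i F) (j : Fin (i + 1)) :
    P.coord j = OnePoint.infty ↔ coordFun i j ∉ P.localRing := by
  rw [coord]
  split_ifs with h
  · exact iff_of_false (OnePoint.coe_ne_infty _) (not_not.mpr h)
  · exact iff_of_true rfl h

theorem coord_zero_eq_coe_iff (Q : RationalPoint i F) (a : F) :
    Q.coord 0 = (a : OnePoint F) ↔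
      (Q.toPlace.comap (pullback i.zero_le)).HasValue (coordFun 0 0) a := by
  rw [coord_eq_coe_iff, Place.hasValue_comap, pullback_coordFun]
  rfl

theorem coord_zero_eq_infty_iff (Q : RationalPoint i F) :
    Q.coord 0 = OnePoint.infty ↔
      (Q.toPlace.comap (pullback i.zero_le)).HasValue (coordFun 0 0)⁻¹ 0 := by
  have hx : coordFun 0 0 ≠ 0 := fun h => transcendental_coordFun_zero (h ▸ isAlgebraic_zero)
  rw [coord_eq_infty_iff, Place.hasValue_zero_iff_inv_notMem (inv_ne_zero hx), inv_inv]
  rfl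

theorem coord_zero_ne_one (hF : Nat.card F = 8) (hi : 1 ≤ i) (Q : RationalPoint i F) :
    Q.coord 0 ≠ ((1 : F) : OnePoint F) := by
  have := charP_two_of_card_eq_eight hF
  intro h
  rw [coord_zero_eq_coe_iff, ← comap_pullback_pullback (Nat.le_succ 0) hi] at h
  obtain ⟨c, -, hc⟩ := exists_hasValue_coordFun_last_succ h one_ne_zero
  rw [CharTwo.add_self_eq_zero, zero_add, div_one] at hc
  exact sq_add_self_ne_one hF c hc

theorem not_exists_coord_zero_eq_iff (hF : Nat.card F = 8) (hi : 1 ≤ i) (Q : RationalPoint i F) :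
    (¬ ∃ a : F, a ≠ 0 ∧ a ≠ 1 ∧ Q.coord 0 = (a : OnePoint F)) ↔
      Q.coord 0 = ((0 : F) : OnePoint F) ∨ Q.coord 0 = OnePoint.infty := by
  have hone := Q.coord_zero_ne_one hF hi
  generalize Q.coord 0 = o at hone
  induction o using OnePoint.rec with
  | infty => simp
  | coe b =>
    simp only [OnePoint.coe_eq_coe, OnePoint.coe_ne_infty, or_false, ne_eq] at hone ⊢
    refine ⟨fun h => ?_, ?_⟩
    · by_contra hb
      exact h ⟨b, hb, hone, rfl⟩
    · rintro rfl ⟨a, ha, -, rfl⟩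
      exact ha rfl

theorem existsUnique_coord_zero_eq [Finite F] [CharP F 2] (a : F) :
    ∃! P : RationalPoint 0 F, P.coord 0 = (a : OnePoint F) := by
  simp only [coord_eq_coe_iff]
  exact (equivPlace 0 F).bijective.existsUnique_iff.mp (existsUnique_place_hasValue_coordFun_zero a)

theorem exists_isTotallyRamified [Finite F] {P : Place (functionField 0) F}
    (hP : HasSimplePole P.ring.valuation (rhs 0)) (i : ℕ) :
    ∃ Q : RationalPoint i F,
      (∀ Q' : RationalPoint i F, Q'.toPlace.comap (pullback i.zero_le) = P ↔ Q' = Q) ∧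
      (∀ j, j ≠ 0 → Q.coord j = OnePoint.infty) ∧
      Q.toClosedPoint.IsTotallyRamified i.zero_le := by
  obtain ⟨R, hR, hRu⟩ := existsUnique_place_comap_eq hP i
  obtain ⟨Q, rfl⟩ := (equivPlace i F).surjective R
  refine ⟨Q, fun Q' => ⟨fun hQ' => (equivPlace i F).injective (hRu _ hQ'), ?_⟩, fun j hj => ?_, ?_⟩
  · rintro rfl
    exact hR
  · rw [coord_eq_infty_iff, ← ValuationSubring.valuation_le_one_iff, not_le]
    subst hR
    exact one_lt_valuation_coordFun (hP.of_isEquiv (isEquiv_valuation_comap _ _).symm) hj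
  · subst hR
    exact ClosedPoint.isTotallyRamified_of_hasSimplePole hP

theorem exists_isTotallyRamified_zero [Finite F] [CharP F 2] (i : ℕ) :
    ∃ Q : RationalPoint i F,
      (∀ Q' : RationalPoint i F, Q'.coord 0 = ((0 : F) : OnePoint F) ↔ Q' = Q) ∧
      (∀ j, j ≠ 0 → Q.coord j = OnePoint.infty) ∧
      Q.toClosedPoint.IsTotallyRamified i.zero_le := by
  obtain ⟨P, hP, hPu⟩ := existsUnique_place_hasValue_coordFun_zero (0 : F)
  have hiff : ∀ R : Place (functionField 0) F, R.HasValue (coordFun 0 0) 0 ↔ R = P :=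
    fun R => ⟨hPu R, fun h => h ▸ hP⟩
  simp only [coord_zero_eq_coe_iff, hiff]
  exact exists_isTotallyRamified (hasSimplePole_rhs_zero_of_hasValue hP) i

theorem exists_isTotallyRamified_infty [Finite F] [CharP F 2] (i : ℕ) :
    ∃ Q : RationalPoint i F,
      (∀ Q' : RationalPoint i F, Q'.coord 0 = OnePoint.infty ↔ Q' = Q) ∧
      (∀ j, Q.coord j = OnePoint.infty) ∧
      Q.toClosedPoint.IsTotallyRamified i.zero_le := by
  obtain ⟨P, hP, hPu⟩ := existsUnique_place_hasValue_coordFun_zero_inv (F := F)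
  have hiff : ∀ R : Place (functionField 0) F, R.HasValue (coordFun 0 0)⁻¹ 0 ↔ R = P :=
    fun R => ⟨hPu R, fun h => h ▸ hP⟩
  obtain ⟨Q, hQ, hcoord, hram⟩ :=
    exists_isTotallyRamified (hasSimplePole_rhs_zero_of_hasValue_inv hP) i
  simp only [← hiff, ← coord_zero_eq_infty_iff] at hQ
  refine ⟨Q, hQ, fun j => ?_, hram⟩
  rcases eq_or_ne j 0 with rfl | hj
  exacts [(hQ Q).mpr rfl, hcoord j hj]

theorem splitsCompletely_of_coord_zero_eq (hF : Nat.card F = 8) {a : F} (ha0 : a ≠ 0)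
    (ha1 : a ≠ 1) {P : RationalPoint 0 F} (hP : P.coord 0 = (a : OnePoint F)) (i : ℕ) :
    P.SplitsCompletely i.zero_le := by
  have := finite_of_card_eq_eight hF
  rw [SplitsCompletely, coverDegree_zero,
    ← card_place_comap_eq hF ((P.coord_eq_coe_iff 0 a).mp hP) ha0 ha1 i]
  exact Nat.card_congr ((equivPlace i F).subtypeEquiv fun Q =>
    (equivPlace 0 F).injective.eq_iff.symm)

theorem card_coord_zero_eq (hF : Nat.card F = 8) {a : F} (ha0 : a ≠ 0) (ha1 : a ≠ 1) (i : ℕ) :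
    Nat.card {Q : RationalPoint i F // Q.coord 0 = (a : OnePoint F)} = 2 ^ i := by
  have := finite_of_card_eq_eight hF
  have := charP_two_of_card_eq_eight hF
  obtain ⟨P, hP, hPu⟩ := existsUnique_coord_zero_eq a
  rw [← coverDegree_zero, ← splitsCompletely_of_coord_zero_eq hF ha0 ha1 hP i]
  refine Nat.card_congr (Equiv.subtypeEquivRight fun Q => ?_)
  rw [Q.coord_zero_eq_coe_iff]
  refine ⟨fun h => hPu _ ((coord_eq_coe_iff _ _ _).mpr h), ?_⟩
  rintro rfl
  exact (coord_eq_coe_iff _ _ _).mp hP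

theorem card_exists_coord_zero_eq (hF : Nat.card F = 8) (i : ℕ) :
    Nat.card {Q : RationalPoint i F // ∃ a : F, a ≠ 0 ∧ a ≠ 1 ∧ Q.coord 0 = (a : OnePoint F)} =
      6 * 2 ^ i := by
  rw [card_subtype_comp (fun Q : RationalPoint i F => Q.coord 0)
    (fun o => ∃ a : F, a ≠ 0 ∧ a ≠ 1 ∧ o = (a : OnePoint F)) (pow_ne_zero i two_ne_zero)]
  · rw [← card_ne_zero_and_ne_one hF]
    congr 1
    refine (Nat.card_congr (Equiv.ofBijective (fun a => ⟨a, a, a.2.1, a.2.2, rfl⟩) ⟨?_, ?_⟩)).symm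
    · exact fun a b h => Subtype.ext (OnePoint.coe_injective (congrArg Subtype.val h))
    · rintro ⟨_, a, ha0, ha1, rfl⟩
      exact ⟨⟨a, ha0, ha1⟩, rfl⟩
  · rintro _ ⟨a, ha0, ha1, rfl⟩
    exact card_coord_zero_eq hF ha0 ha1 i

theorem card_eq_of_iff (hF : Nat.card F = 8) {P₀ P₁ : RationalPoint i F} (hne : P₀ ≠ P₁)
    (h : ∀ Q : RationalPoint i F,
      (¬ ∃ a : F, a ≠ 0 ∧ a ≠ 1 ∧ Q.coord 0 = (a : OnePoint F)) ↔ Q = P₀ ∨ Q = P₁) :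
    Nat.card (RationalPoint i F) = 6 * 2 ^ i + 2 := by
  classical
  let IsSplit : RationalPoint i F → Prop := fun Q =>
    ∃ a : F, a ≠ 0 ∧ a ≠ 1 ∧ Q.coord 0 = (a : OnePoint F)
  have hsplit : Nat.card {Q // IsSplit Q} = 6 * 2 ^ i := card_exists_coord_zero_eq hF i
  have hpair : Nat.card {Q // ¬ IsSplit Q} = 2 := by
    rw [Nat.card_congr (Equiv.subtypeEquivRight h), ← Set.ncard_pair hne]
    rfl
  have : Finite {Q // IsSplit Q} := Nat.finite_of_card_ne_zero (by rw [hsplit]; positivity)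
  have : Finite {Q // ¬ IsSplit Q} := Nat.finite_of_card_ne_zero (by rw [hpair]; decide)
  rw [← Nat.card_congr (Equiv.sumCompl IsSplit), Nat.card_sum, hsplit, hpair]

end RationalPoint

end ArtinSchreierTower

theorem mainTheorem3 {F : Type*} [Field F] (hF : Nat.card F = 8) (i : ℕ) (hi : 1 ≤ i) :
    -- the cover `Cᵢ → C₀` has degree `2 ^ i`; the number of `𝔽₈`-rational points of `Cᵢ`
    ArtinSchreierTower.coverDegree 0 i = 2 ^ i ∧
    Nat.card (ArtinSchreierTower.RationalPoint i F) = 6 * 2 ^ i + 2 ∧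
    -- the points of `C₀` with `x₀ ∈ 𝔽₈ - 𝔽₂` split completely
    (∀ a : F, a ≠ 0 → a ≠ 1 →
      (∃! P : ArtinSchreierTower.RationalPoint 0 F, P.coord 0 = (a : OnePoint F)) ∧
      ∀ P : ArtinSchreierTower.RationalPoint 0 F, P.coord 0 = (a : OnePoint F) →
        P.SplitsCompletely (Nat.zero_le i)) ∧
    -- the remaining rational points are `P(0, ∞, …, ∞)` and `P(∞, …, ∞)`
    ∃ P₀ P₁ : ArtinSchreierTower.RationalPoint i F,
      (P₀.coord 0 = ((0 : F) : OnePoint F) ∧ ∀ j, j ≠ 0 → P₀.coord j = OnePoint.infty) ∧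
      (∀ j, P₁.coord j = OnePoint.infty) ∧
      P₀.toClosedPoint.IsTotallyRamified (Nat.zero_le i) ∧
      P₁.toClosedPoint.IsTotallyRamified (Nat.zero_le i) ∧
      ∀ Q : ArtinSchreierTower.RationalPoint i F,
        (¬ ∃ a : F, a ≠ 0 ∧ a ≠ 1 ∧ Q.coord 0 = (a : OnePoint F)) ↔ Q = P₀ ∨ Q = P₁ := by
  have := finite_of_card_eq_eight hF
  have := charP_two_of_card_eq_eight hF
  obtain ⟨P₀, h₀, hcoord₀, hram₀⟩ :=
    ArtinSchreierTower.RationalPoint.exists_isTotallyRamified_zero (F := F) i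
  obtain ⟨P₁, h₁, hcoord₁, hram₁⟩ :=
    ArtinSchreierTower.RationalPoint.exists_isTotallyRamified_infty (F := F) i
  have hrest : ∀ Q : ArtinSchreierTower.RationalPoint i F,
      (¬ ∃ a : F, a ≠ 0 ∧ a ≠ 1 ∧ Q.coord 0 = (a : OnePoint F)) ↔ Q = P₀ ∨ Q = P₁ := fun Q => by
    rw [Q.not_exists_coord_zero_eq_iff hF hi, h₀, h₁]
  have hne : P₀ ≠ P₁ := by
    rintro rfl
    exact OnePoint.coe_ne_infty _ (((h₀ P₀).mpr rfl).symm.trans (hcoord₁ 0))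
  exact ⟨ArtinSchreierTower.coverDegree_zero i,
    ArtinSchreierTower.RationalPoint.card_eq_of_iff hF hne hrest,
    fun a ha0 ha1 => ⟨ArtinSchreierTower.RationalPoint.existsUnique_coord_zero_eq a, fun P hP =>
      P.splitsCompletely_of_coord_zero_eq hF ha0 ha1 hP i⟩,
    P₀, P₁, ⟨(h₀ P₀).mpr rfl, hcoord₀⟩, hcoord₁, hram₀, hram₁, hrest⟩
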